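/- For $m\in\mathbb N_0$ let $q_m(x)=\sum_{j=0}^{m}\frac{x^j}{j!}\binom{m+1}{j+1}$, a polynomial of degree $m$. Let $\mathbb H=\{\operatorname{Im}\theta>0\}$, $\mathbb D=\{|z|<1\}$, $\mathbb T=\{|z|=1\}$, and fix $t>0$. There is a unique function $\zeta_t$ that is continuous on $\overline{\mathbb H}$, analytic on $\mathbb H$, solves $\zeta_t(\theta)-t\tan\zeta_t(\theta)=\theta$ for $\theta\in\mathbb H$, and is such that $\zeta_t(\theta)-\theta$ is bounded on $\{\operatorname{Im}\theta>\tau_0\}$ for some $\tau_0>0$ (the principal branch). It has a representation $\zeta_t(\theta)=\theta+i t\, r_t(e^{2i\theta})$, $\theta\in\mathbb H$, where $r_t$ is analytic on $\mathbb D$ and $$z=e^{2t r_t(z)}\,\frac{1-r_t(z)}{1+r_t(z)},\qquad r_t(z)=1+2\sum_{\ell=1}^\infty\frac{(-1)^\ell}{\ell}e^{-2\ell t}q_{\ell-1}(-4\ell t)z^\ell,\qquad z\in\mathbb D. \qquad (*)$$ Moreover $\operatorname{Re} r_t>0$ on $\mathbb D$; on $(-1,1)$ the function $r_t$ is real and strictly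 decreasing; and $r_t(0)=1$. At the boundary (with $r_t$ also denoting the extensions): (i) If $t>1$, let $R=e^{2\sqrt{t(t-1)}-2\operatorname{arccosh}\sqrt t}$. Then $R>1$; $r_t$ extends to a continuous function on $\{|z|\le R\}$ that is analytic at every point of this closed disk except possibly at $z=R$ (in particular on the open disk $\{|z|<R\}$), and the series in $(*)$ converges to it uniformly on $\{|z|\le R\}$, in particular uniformly on $\mathbb T$. Also $\operatorname{Re} r_t>0$ on $\mathbb T$. (ii) If $0<t\le 1$, then $r_t$ extends continuously to $\overline{\mathbb D}$, the series in $(*)$ converges to $r_t$ uniformly on $\overline{\mathbb D}$ but diverges at every $z$ with $|z|>1$, and $r_t(1)=0$. (iii) If $0<t<1$, let $x_t=\arccos\sqrt t-\sqrt{t(1-t)}$. Then $x_t\in(0,\frac\pi2)$, and $r_t$ extends analytically to a small disk around every $z_0\in\mathbb T\setminus\{e^{2ix_t},e^{-2ix_t}\}$. At each of $z_0=e^{\pm2ix_t}$ it has a square-root singularity: for $z\in\overline{\mathbb D}$ near $z_0$, $r_t(z)=\sum_{n\ge0}a_n\,((z-z_0)^{1/2})^n$ is a convergent series with $a_1\neq0$,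 for a continuous branch of $(z-z_0)^{1/2}$ on $\overline{\mathbb D}$. One has $\operatorname{Re} r_t(e^{2i\theta})=0$ for $\theta\in[-x_t,x_t]$ and $\operatorname{Re} r_t(e^{2i\theta})>0$ for $\theta\in[-\frac\pi2,\frac\pi2]\setminus[-x_t,x_t]$. The analytic extension at $1$ satisfies $r_t'(1)=\frac1{2t-2}=-r_t''(1)$. (iv) If $t=1$, then $r_1$ extends analytically to a small disk around every $z_0\in\mathbb T\setminus\{1\}$. At $z_0=1$ it has a cubic-root singularity: for $z\in\overline{\mathbb D}$ near $1$, $r_1(z)=\sum_{n\ge1}a_n\,((1-z)^{1/3})^n$ is a convergent series with $a_1=(3/2)^{1/3}>0$ and the principal cube root. Also $\operatorname{Re} r_1>0$ on $\mathbb T\setminus\{1\}$ and $r_1(1)=0$. -/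

import Mathlib

open Filter Topology Set Metric

noncomputable section

namespace UnitaryPoisson

/-- `ζ` is the principal branch of the multivalued solution of `ζ - t tan ζ = θ`: analytic on the
upper half-plane, continuous on its closure, solving the equation, with `ζ(θ) - θ` bounded on some
half-plane `Im θ > τ₀`, `τ₀ > 0`. (Only the values on the closed upper half-plane matter. At the
poles of the tangent, where Mathlib sets `tan = 0`, the equation would force `θ = ζ θ` to be real,
so no such value can occur in the equation below.) -/
structure IsPrincipalBranch (t : ℝ) (ζ : ℂ → ℂ) : Prop where
  analytic : AnalyticOnNhd ℂ ζ {θ : ℂ | 0 < θ.im}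
  continuous : ContinuousOn ζ {θ : ℂ | 0 ≤ θ.im}
  equation : ∀ θ : ℂ, 0 < θ.im → ζ θ - (t : ℂ) * Complex.tan (ζ θ) = θ
  bounded : ∃ τ₀ : ℝ, 0 < τ₀ ∧ ∃ B : ℝ, ∀ θ : ℂ, τ₀ < θ.im → ‖ζ θ - θ‖ ≤ B

/-- `q_m(x) = ∑_{j=0}^m (x^j / j!) * binom(m+1, j+1)`. -/
def q (m : ℕ) : Polynomial ℝ :=
  ∑ j ∈ Finset.range (m + 1),
    Polynomial.C (((m + 1).choose (j + 1) : ℝ) / (j.factorial : ℝ)) * Polynomial.X ^ j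

/-- The `N`-th partial sum
`1 + 2 ∑_{ℓ=1}^N ((-1)^ℓ / ℓ) e^{-2ℓt} q_{ℓ-1}(-4ℓt) z^ℓ` of the Taylor series. -/
def taylorPartialSum (t : ℝ) (N : ℕ) (z : ℂ) : ℂ :=
  1 + 2 * ∑ l ∈ Finset.Icc 1 N,
    (((-1 : ℝ) ^ l / (l : ℝ) * Real.exp (-2 * (l : ℝ) * t) *
      (q (l - 1)).eval (-4 * (l : ℝ) * t) : ℝ) : ℂ) * z ^ l

/-- The function `r`, given on the closed unit disk, extends analytically to a small disk centered
at `z₀`. -/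
def ExtendsAnalyticallyAt (r : ℂ → ℂ) (z₀ : ℂ) : Prop :=
  ∃ ε : ℝ, 0 < ε ∧ ∃ F : ℂ → ℂ,
    AnalyticOnNhd ℂ F (ball z₀ ε) ∧ EqOn F r (ball z₀ ε ∩ closedBall (0 : ℂ) 1)

/-- The function `r`, given on the closed unit disk, has a square-root singularity at `z₀`: for a
continuous branch `s` of `(z - z₀)^{1/2}` on the closed disk, `r` is near `z₀` the sum of a
convergent series `∑ aₙ s(z)ⁿ`, with `a₁ ≠ 0`. -/
def HasSquareRootSingularity (r : ℂ → ℂ) (z₀ : ℂ) : Prop :=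
  ∃ s : ℂ → ℂ, ContinuousOn s (closedBall (0 : ℂ) 1) ∧
    (∀ z ∈ closedBall (0 : ℂ) 1, s z ^ 2 = z - z₀) ∧
    ∃ a : ℕ → ℂ, a 1 ≠ 0 ∧
      ∀ᶠ z in 𝓝[closedBall (0 : ℂ) 1] z₀, HasSum (fun n : ℕ => a n * s z ^ n) (r z)

/-- `x_t = arccos √t - √(t(1-t))`. -/
def xt (t : ℝ) : ℝ := Real.arccos (√t) - √(t * (1 - t))

/-- `exp (2 √(t(t-1)) - 2 arccosh √t)`. -/
def radius (t : ℝ) : ℝ := Real.exp (2 * √(t * (t - 1)) - 2 * Real.arcosh (√t))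

end UnitaryPoisson

end

/-!
Clearing denominators in `z = e^{2tw} (1 - w) / (1 + w)` gives `(w - 1) + z (1 + w) e^{-2tw} = 0`,
where the left side (`defect t z w`) is entire in `w`. Everything about `r_t` follows from a good
choice of a circle `|w - 1| = ρ`, recorded in `Contour t ρ R`: on it `R |(1 + w) e^{-2tw}| ≤ ρ`,
with equality only at points where `t (1 - w²) = 1`, that is, at critical points of
`w ↦ e^{2tw} (1 - w) / (1 + w)`. For `t ≤ 1` the circle of radius `1 / √t` works with `R = 1`
(`contour_inv_sqrt`); for `t > 1` the circle through the positive critical point works with `R`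
the critical value there (`contour_radius`). Both come down to `(1 + y) e^{-y} ≤ 1`.

*Existence and uniqueness of the root.* For `|z| ≤ R` the quotient of `defect t z` by `w - 1` has
nonnegative real part on the circle. Rouché's theorem does not allow equality, so the maximum
principle takes its place. Without zeros in the closed disk, `(w - 1) / defect t z w` would have
positive real part on the circle and vanish at the centre (`Contour.exists_root`). With two
zeros `p`, `q` (or a double one inside), divide by `(w - p) (ρ² - conj (p - 1) (w - 1))`, which
equals `(w - 1) |w - p|²` on the circle, and likewise for `q`; times `w - 1`, the quotient again
vanishes at the centre and has nonnegative real part on the circle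
(`Contour.not_eq_mul_blaschkeNum`). A zero on the circle is a critical point, hence a double zero,
which matches the double zero of the divisor. So `branch t ρ`, the root as a function of `z`, is
continuous on `|z| ≤ R` by compactness, and analytic where the root is inside the circle.

*The series.* The residue theorem for `kernel / defect` on the circle gives the derivative of
`branch`; a geometric expansion turns its Taylor coefficients into integrals of powers of
`kernel t w / (w - 1)`, and Cauchy's formula with Leibniz' rule evaluates them in terms of `q`
(`contourCoeff_succ`). Since the modulus of this function is less than `1 / R` off finitely many
points of the circle, dominated convergence gives `n |aₙ| Rⁿ → 0`, and Tauber's theorem yields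
uniform convergence on the closed disk. A critical root on `|z| = R` prevents an analytic
continuation, hence forces divergence outside.

*The boundary.* At a critical point the map `w ↦ e^{2tw} (1 - w) / (1 + w)` is locally a `k`-th
power, `k = 2` for `t < 1` and `k = 3` for `t = 1`, and the root is an analytic function of
`(1 - z / z₀)^{1/k}` on the closed disk (`Contour.exists_eq_comp_rootBranch`). On the imaginary
axis the map is `iy ↦ e^{2i (ty - arctan y)}`, which identifies the arc where `Re r_t = 0` and its
endpoints, and the differential equation `2 z r' (t (1 - r²) - 1) = 1 - r²` gives the derivatives
at `1`. For the principal branch, `tan ζ = i s` with `ζ = θ + i t s` is the equation for `s` with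
`z = e^{2iθ}`; boundedness of `ζ - θ` puts `s` close to `1` high up in the half-plane.
-/

noncomputable section

namespace UnitaryPoisson

variable {t ρ R : ℝ}

/-! ### Roots on an admissible disk -/

/-- The entire function `w ↦ (1 + w) e^{-2tw}`. -/
def kernel (t : ℝ) (w : ℂ) : ℂ := (1 + w) * Complex.exp (-(2 * t * w))

/-- The entire function of `w` whose zeros are the solutions of `z = e^{2tw} (1 - w) / (1 + w)`. -/
def defect (t : ℝ) (z w : ℂ) : ℂ := (w - 1) + z * kernel t w

lemma hasDerivAt_kernel (t : ℝ) (w : ℂ) :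
    HasDerivAt (kernel t) ((1 - 2 * t * (1 + w)) * Complex.exp (-(2 * t * w))) w := by
  have h1 : HasDerivAt (fun w : ℂ => -(2 * t * w)) (-(2 * t)) w := by
    simpa using ((hasDerivAt_id w).const_mul (2 * (t : ℂ))).fun_neg
  have h2 : HasDerivAt (fun w : ℂ => 1 + w) 1 w := by simpa using (hasDerivAt_id w).const_add 1
  refine (h2.mul h1.cexp).congr_deriv ?_
  ring

lemma differentiable_kernel (t : ℝ) : Differentiable ℂ (kernel t) :=
  fun w => (hasDerivAt_kernel t w).differentiableAt

lemma hasDerivAt_defect (t : ℝ) (z w : ℂ) :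
    HasDerivAt (defect t z) (1 + z * ((1 - 2 * t * (1 + w)) * Complex.exp (-(2 * t * w)))) w :=
  ((hasDerivAt_id w).sub_const 1).add ((hasDerivAt_kernel t w).const_mul z)

lemma differentiable_defect (t : ℝ) (z : ℂ) : Differentiable ℂ (defect t z) :=
  fun w => (hasDerivAt_defect t z w).differentiableAt

lemma continuous_defect (t : ℝ) : Continuous fun p : ℂ × ℂ => defect t p.1 p.2 := by
  unfold defect kernel; fun_prop

lemma one_add_ne_zero_of_defect {t : ℝ} {z w : ℂ} (h : defect t z w = 0) : 1 + w ≠ 0 := by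
  intro h1
  have hw : w = -1 := by linear_combination h1
  simp [defect, kernel, hw] at h
  norm_num at h

lemma one_add_mul_deriv_defect {t : ℝ} {z w : ℂ} (h : defect t z w = 0) :
    (1 + w) * deriv (defect t z) w = 2 * (1 - t * (1 - w ^ 2)) := by
  rw [(hasDerivAt_defect t z w).deriv]
  unfold defect kernel at h
  linear_combination (1 - 2 * t * (1 + w)) * h

lemma deriv_defect_eq_zero_iff {t : ℝ} {z w : ℂ} (h : defect t z w = 0) :
    deriv (defect t z) w = 0 ↔ t * (1 - w ^ 2) = 1 := by
  have h1 := one_add_mul_deriv_defect h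
  have h2 := one_add_ne_zero_of_defect h
  constructor
  · intro h3
    rw [h3] at h1
    linear_combination h1 / 2
  · intro h3
    rw [h3] at h1
    simpa [h2] using h1

lemma eq_exp_mul_of_defect {t : ℝ} {z w : ℂ} (h : defect t z w = 0) :
    z = Complex.exp (2 * t * w) * ((1 - w) / (1 + w)) := by
  have h2 := one_add_ne_zero_of_defect h
  unfold defect kernel at h
  have h3 : Complex.exp (2 * t * w) * Complex.exp (-(2 * t * w)) = 1 := by
    rw [← Complex.exp_add]; simp
  field_simp
  linear_combination Complex.exp (2 * t * w) * h - z * (1 + w) * h3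

lemma defect_eq_zero_of_eq {t : ℝ} {z w : ℂ} (h2 : 1 + w ≠ 0)
    (h : z = Complex.exp (2 * t * w) * ((1 - w) / (1 + w))) : defect t z w = 0 := by
  have h3 : Complex.exp (2 * t * w) * Complex.exp (-(2 * t * w)) = 1 := by
    rw [← Complex.exp_add]; simp
  unfold defect kernel
  have h4 : (1 - w) / (1 + w) * (1 + w) = 1 - w := div_mul_cancel₀ _ h2
  rw [h]
  linear_combination (1 - w) * h3 +
    Complex.exp (2 * t * w) * Complex.exp (-(2 * t * w)) * h4

lemma norm_kernel_sq (t : ℝ) (w : ℂ) :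
    ‖kernel t w‖ ^ 2 = ‖1 + w‖ ^ 2 * Real.exp (-(4 * t * w.re)) := by
  have : (-(2 * (t : ℂ) * w)).re = -(2 * t * w.re) := by simp [Complex.mul_re]
  rw [kernel, norm_mul, mul_pow, Complex.norm_exp, this, ← Real.exp_nat_mul]
  congr 2
  push_cast; ring

/-- The circle of centre `1` and radius `ρ` is admissible for `R` if `z ↦ 1 - z (1 + w) e^{-2tw}`
maps it into the closed disk it bounds whenever `|z| ≤ R`, and if the extremal case occurs only at
critical points of `w ↦ e^{2tw} (1 - w) / (1 + w)`. -/
structure Contour (t ρ R : ℝ) : Prop where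
  radius_pos : 0 < ρ
  one_le : 1 ≤ R
  norm_le : ∀ w ∈ sphere (1 : ℂ) ρ, R * ‖kernel t w‖ ≤ ρ
  critical : ∀ w ∈ sphere (1 : ℂ) ρ, R * ‖kernel t w‖ = ρ → t * (1 - w ^ 2) = 1

/-- The minimum principle for the harmonic function `Re V`, with the minimum at the centre. -/
lemma re_eq_zero_of_re_nonneg_on_sphere {V : ℂ → ℂ} {c : ℂ} {ρ : ℝ} (hρ : 0 < ρ)
    (hV : DiffContOnCl ℂ V (ball c ρ)) (h : ∀ w ∈ sphere c ρ, 0 ≤ (V w).re) (hc : (V c).re = 0) :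
    ∀ w ∈ closedBall c ρ, (V w).re = 0 := by
  have hE : DiffContOnCl ℂ (fun w => Complex.exp (-V w)) (ball c ρ) :=
    Complex.differentiable_exp.comp_diffContOnCl hV.neg
  have hn : ∀ w, ‖Complex.exp (-V w)‖ = Real.exp (-(V w).re) := fun w => by
    rw [Complex.norm_exp, Complex.neg_re]
  have hle : ∀ w ∈ closure (ball c ρ), ‖Complex.exp (-V w)‖ ≤ 1 := fun w hw => by
    refine Complex.norm_le_of_forall_mem_frontier_norm_le isBounded_ball hE (fun z hz => ?_) hw
    rw [frontier_ball c hρ.ne'] at hz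
    rw [hn]
    exact Real.exp_le_one_iff.2 (by linarith [h z hz])
  have hmax : IsMaxOn (norm ∘ fun w => Complex.exp (-V w)) (ball c ρ) c := by
    intro w hw
    simp only [mem_ofPred_eq, Function.comp]
    rw [hn c, hc]
    simpa using hle w (subset_closure hw)
  intro w hw
  have := Complex.norm_eqOn_closedBall_of_isMaxOn hE hmax hw
  simp only [Function.comp, Function.const] at this
  rw [hn, hn, hc] at this
  simpa using this

namespace Contour

/-- On the circle, `defect / (w - 1) = 1 + u` with `|u| ≤ 1`. -/
lemma norm_mul_kernel_le (C : Contour t ρ R) {z w : ℂ} (hz : ‖z‖ ≤ R) (hw : w ∈ sphere (1 : ℂ) ρ) :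
    ‖z * kernel t w / (w - 1)‖ ≤ 1 := by
  have hw' : ‖w - 1‖ = ρ := by simpa [dist_eq_norm] using hw
  rw [norm_div, norm_mul, hw', div_le_one C.radius_pos]
  exact (mul_le_mul_of_nonneg_right hz (norm_nonneg _)).trans (C.norm_le w hw)

lemma sub_one_ne_zero (C : Contour t ρ R) {w : ℂ} (hw : w ∈ sphere (1 : ℂ) ρ) : w - 1 ≠ 0 := by
  have hw' : ‖w - 1‖ = ρ := by simpa [dist_eq_norm] using hw
  exact norm_pos_iff.1 (hw' ▸ C.radius_pos)

lemma defect_eq_sub_one_mul (C : Contour t ρ R) {z w : ℂ} (hw : w ∈ sphere (1 : ℂ) ρ) :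
    defect t z w = (w - 1) * (1 + z * kernel t w / (w - 1)) := by
  have := C.sub_one_ne_zero hw
  unfold defect
  field_simp

/-- Without a root, `(w - 1) / defect` would vanish at the centre of the disk and have positive real
part on the circle. -/
lemma exists_root (C : Contour t ρ R) {z : ℂ} (hz : ‖z‖ ≤ R) :
    ∃ w ∈ closedBall (1 : ℂ) ρ, defect t z w = 0 := by
  by_contra! hno
  have hρ := C.radius_pos
  have hV : DiffContOnCl ℂ (fun w => (w - 1) / defect t z w) (ball 1 ρ) := by
    refine DifferentiableOn.diffContOnCl fun w hw => ?_
    rw [closure_ball _ hρ.ne'] at hw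
    exact ((differentiableAt_id.sub_const 1).div (differentiable_defect t z w)
      (hno w hw)).differentiableWithinAt
  have key : ∀ w ∈ sphere (1 : ℂ) ρ, 0 < ((w - 1) / defect t z w).re := by
    intro w hw
    have h0 := hno w (sphere_subset_closedBall hw)
    have h1 := C.sub_one_ne_zero hw
    have h2 := C.norm_mul_kernel_le hz hw
    rw [C.defect_eq_sub_one_mul hw] at h0 ⊢
    set u := z * kernel t w / (w - 1) with hu
    have h3 : 1 + u ≠ 0 := right_ne_zero_of_mul h0
    have h4 : (w - 1) / ((w - 1) * (1 + u)) = (1 + u)⁻¹ := by field_simp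
    rw [h4, Complex.inv_re]
    refine div_pos ?_ (Complex.normSq_pos.2 h3)
    have h5 := (abs_le.1 ((Complex.abs_re_le_norm u).trans h2)).1
    refine lt_of_le_of_ne (by simp; linarith) fun h6 => h3 ?_
    have h7 : u.re = -1 := by simp at h6; linarith
    have h8 : u.re * u.re + u.im * u.im ≤ 1 := by
      rw [← Complex.normSq_apply, Complex.normSq_eq_norm_sq]
      exact pow_le_one₀ (norm_nonneg _) h2
    have h9 : u.im = 0 := by rw [h7] at h8; nlinarith [mul_self_nonneg u.im]
    apply Complex.ext <;> simp [h7, h9]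
  have hw : (1 + ρ : ℂ) ∈ sphere (1 : ℂ) ρ := by simp [abs_of_pos hρ]
  have h1 := key _ hw
  have h2 := re_eq_zero_of_re_nonneg_on_sphere hρ hV (fun w hw => (key w hw).le) (by simp) _
    (sphere_subset_closedBall hw)
  linarith

/-- On the circle, a zero of `defect` is a critical point, hence a double zero. -/
lemma deriv_defect_eq_zero (C : Contour t ρ R) {z w : ℂ} (hz : ‖z‖ ≤ R)
    (hw : w ∈ sphere (1 : ℂ) ρ) (h : defect t z w = 0) : deriv (defect t z) w = 0 := by
  rw [deriv_defect_eq_zero_iff h]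
  refine C.critical w hw (le_antisymm (C.norm_le w hw) ?_)
  have hw' : ‖w - 1‖ = ρ := by simpa [dist_eq_norm] using hw
  have h1 : w - 1 = -(z * kernel t w) := by unfold defect at h; linear_combination h
  rw [← hw', h1, norm_neg, norm_mul]
  gcongr

end Contour

/-! ### Uniqueness of the root -/

lemma analyticOnNhd_dslope {f : ℂ → ℂ} {S : Set ℂ} (hf : AnalyticOnNhd ℂ f S) {p : ℂ} (hp : p ∈ S) :
    AnalyticOnNhd ℂ (dslope f p) S := by
  intro w hw
  rcases eq_or_ne w p with rfl | hne
  · obtain ⟨s, hs⟩ := hf w hp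
    exact ⟨_, hs.has_fpower_series_dslope_fslope⟩
  · have h1 : AnalyticAt ℂ (fun w => (w - p)⁻¹ * (f w - f p)) w :=
      ((analyticAt_id.sub analyticAt_const).inv (sub_ne_zero.2 hne)).mul
        ((hf w hw).sub analyticAt_const)
    refine h1.congr ?_
    filter_upwards [dslope_eventuallyEq_slope_of_ne f hne] with x hx
    rw [hx, slope_def_module, smul_eq_mul]

/-- The numerator of a Blaschke factor: it vanishes at `p` and at the reflection of `p` in the
circle of centre `1` and radius `ρ`. -/
def blaschkeNum (ρ : ℝ) (p w : ℂ) : ℂ := (w - p) * (ρ ^ 2 - (starRingEnd ℂ) (p - 1) * (w - 1))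

/-- On the circle a `blaschkeNum` differs from `w - 1` by a nonnegative factor only. -/
lemma blaschkeNum_eq_on_sphere {p w : ℂ} (hw : w ∈ sphere (1 : ℂ) ρ) :
    blaschkeNum ρ p w = (w - 1) * ((‖w - p‖ ^ 2 : ℝ) : ℂ) := by
  have hw' : ‖w - 1‖ = ρ := by simpa [dist_eq_norm] using hw
  have h1 := Complex.mul_conj' (w - 1)
  have h2 := Complex.mul_conj' (w - p)
  rw [hw'] at h1
  simp only [map_sub, map_one] at h1 h2
  unfold blaschkeNum
  simp only [map_sub, map_one]
  push_cast
  rw [← h1, ← h2]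
  ring

lemma blaschkeNum_second_ne_zero {p w : ℂ} (hρ : 0 < ρ) (hp : p ∈ closedBall (1 : ℂ) ρ)
    (hw : w ∈ closedBall (1 : ℂ) ρ) (h : p ∈ ball (1 : ℂ) ρ ∨ w ≠ p) :
    (ρ : ℂ) ^ 2 - (starRingEnd ℂ) (p - 1) * (w - 1) ≠ 0 := by
  intro h0
  rw [mem_closedBall, dist_eq_norm] at hp hw
  rw [mem_ball, dist_eq_norm] at h
  have h1 : (ρ : ℂ) ^ 2 = (starRingEnd ℂ) (p - 1) * (w - 1) := by linear_combination h0
  have h2 : ρ ^ 2 = ‖p - 1‖ * ‖w - 1‖ := by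
    have := congrArg norm h1
    rwa [norm_mul, RCLike.norm_conj, norm_pow, Complex.norm_real, Real.norm_of_nonneg hρ.le] at this
  have h3 : ‖p - 1‖ = ρ := by nlinarith [norm_nonneg (p - 1), norm_nonneg (w - 1)]
  rcases h with h | h
  · exact absurd h3 h.ne
  · apply h
    have h4 := Complex.conj_mul' (p - 1)
    rw [h3] at h4
    have h5 : (starRingEnd ℂ) (p - 1) ≠ 0 := by
      rw [ne_eq, map_eq_zero, ← norm_eq_zero, h3]; exact hρ.ne'
    have h6 : (starRingEnd ℂ) (p - 1) * (w - p) = 0 := by linear_combination -h1 - h4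
    exact sub_eq_zero.1 ((mul_eq_zero.1 h6).resolve_left h5)

lemma blaschkeNum_ne_zero {p w : ℂ} (hρ : 0 < ρ) (hp : p ∈ closedBall (1 : ℂ) ρ)
    (hw : w ∈ closedBall (1 : ℂ) ρ) (h : w ≠ p) : blaschkeNum ρ p w ≠ 0 :=
  mul_ne_zero (sub_ne_zero.2 h) (blaschkeNum_second_ne_zero hρ hp hw (Or.inr h))

lemma differentiable_blaschkeNum (p : ℂ) : Differentiable ℂ (blaschkeNum ρ p) := by
  unfold blaschkeNum; fun_prop

/-- Division by `blaschkeNum`. A zero on the circle has to be double, since `blaschkeNum` has a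
double zero there. -/
lemma exists_eq_blaschkeNum_mul (hρ : 0 < ρ) {f : ℂ → ℂ} (hf : AnalyticOnNhd ℂ f (closedBall 1 ρ))
    {p : ℂ} (hp : p ∈ closedBall (1 : ℂ) ρ) (h0 : f p = 0)
    (h1 : p ∈ sphere (1 : ℂ) ρ → deriv f p = 0) :
    ∃ g : ℂ → ℂ, AnalyticOnNhd ℂ g (closedBall 1 ρ) ∧
      ∀ w ∈ closedBall (1 : ℂ) ρ, f =ᶠ[𝓝 w] fun x => blaschkeNum ρ p x * g x := by
  have hs : ∀ x, f x = (x - p) * dslope f p x := fun x => by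
    simpa [h0] using (sub_smul_dslope f p x).symm
  have hd := analyticOnNhd_dslope hf hp
  by_cases hb : p ∈ ball (1 : ℂ) ρ
  · have han : AnalyticOnNhd ℂ (fun x : ℂ => (ρ : ℂ) ^ 2 - (starRingEnd ℂ) (p - 1) * (x - 1))
        (closedBall 1 ρ) := fun x _ => by fun_prop
    have hne := fun w hw => blaschkeNum_second_ne_zero hρ hp (w := w) hw (Or.inl hb)
    refine ⟨fun x => dslope f p x / ((ρ : ℂ) ^ 2 - (starRingEnd ℂ) (p - 1) * (x - 1)),
      hd.div han hne, fun w hw => ?_⟩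
    filter_upwards [(han w hw).continuousAt.eventually_ne (hne w hw)] with x hx
    rw [hs x, blaschkeNum]
    field_simp
  · have hsph : p ∈ sphere (1 : ℂ) ρ := by
      rw [mem_closedBall] at hp; rw [mem_ball, not_lt] at hb
      exact le_antisymm hp hb
    have h2 : dslope f p p = 0 := by rw [dslope_same, h1 hsph]
    have h3 : ‖p - 1‖ = ρ := by simpa [dist_eq_norm] using hsph
    have h4 := Complex.conj_mul' (p - 1)
    rw [h3] at h4
    have h5 : (starRingEnd ℂ) (p - 1) ≠ 0 := by
      rw [ne_eq, map_eq_zero, ← norm_eq_zero, h3]; exact hρ.ne'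
    have hs2 : ∀ x, dslope f p x = (x - p) * dslope (dslope f p) p x := fun x => by
      have h7 := sub_smul_dslope (dslope f p) p x
      rw [h2, sub_zero, smul_eq_mul] at h7
      exact h7.symm
    refine ⟨fun x => -((starRingEnd ℂ) (p - 1))⁻¹ * dslope (dslope f p) p x,
      analyticOnNhd_const.mul (analyticOnNhd_dslope hd hp), fun w hw => .of_forall fun x => ?_⟩
    have h6 : (ρ : ℂ) ^ 2 - (starRingEnd ℂ) (p - 1) * (x - 1)
        = -((starRingEnd ℂ) (p - 1) * (x - p)) := by
      linear_combination -h4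
    simp only [blaschkeNum]
    rw [hs x, hs2 x, h6]
    field_simp

/-- A nonnegative real part on the circle minus two points extends to the whole circle. -/
lemma re_nonneg_on_sphere_of_ne {V : ℂ → ℂ} (hρ : 0 < ρ) (hV : ContinuousOn V (sphere 1 ρ))
    (p q : ℂ) (h : ∀ w ∈ sphere (1 : ℂ) ρ, w ≠ p → w ≠ q → 0 ≤ (V w).re) :
    ∀ w ∈ sphere (1 : ℂ) ρ, 0 ≤ (V w).re := by
  have hmem : ∀ θ, circleMap 1 ρ θ ∈ sphere (1 : ℂ) ρ := circleMap_mem_sphere 1 hρ.le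
  have hc : Continuous fun θ => (V (circleMap 1 ρ θ)).re :=
    Complex.continuous_re.comp (hV.comp_continuous (continuous_circleMap 1 ρ) hmem)
  have hcl : IsClosed {θ | 0 ≤ (V (circleMap 1 ρ θ)).re} := isClosed_le continuous_const hc
  have hd : Dense (circleMap 1 ρ ⁻¹' {p, q})ᶜ :=
    ((Set.toFinite {p, q}).countable.preimage_circleMap 1 hρ.ne').dense_compl ℝ
  intro w hw
  have : w ∈ range (circleMap 1 ρ) := by rw [range_circleMap, abs_of_pos hρ]; exact hw
  obtain ⟨θ, rfl⟩ := this
  have hsub : (circleMap 1 ρ ⁻¹' {p, q})ᶜ ⊆ {θ | 0 ≤ (V (circleMap 1 ρ θ)).re} := fun φ hφ => by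
    simp only [mem_compl_iff, mem_preimage, mem_insert_iff, mem_singleton_iff, not_or] at hφ
    exact h _ (hmem φ) hφ.1 hφ.2
  exact hcl.closure_subset_iff.2 hsub (hd θ)

namespace Contour

/-- Two zeros of `defect` in the disk, counted with multiplicity, are impossible: dividing by the
corresponding Blaschke numerators and multiplying by `w - 1` gives a function that vanishes at the
centre and has nonnegative real part on the circle. -/
lemma not_eq_mul_blaschkeNum (C : Contour t ρ R) (ht : 0 < t) {z p q : ℂ} (hz : ‖z‖ ≤ R)
    {M : ℂ → ℂ} (hM : AnalyticOnNhd ℂ M (closedBall 1 ρ))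
    (h : ∀ w ∈ closedBall (1 : ℂ) ρ,
      defect t z w = blaschkeNum ρ p w * (blaschkeNum ρ q w * M w)) : False := by
  have hρ := C.radius_pos
  have hcont : ContinuousOn (fun w => (w - 1) * M w) (closedBall 1 ρ) :=
    (by fun_prop : ContinuousOn (fun w : ℂ => w - 1) _).mul hM.continuousOn
  have hV : DiffContOnCl ℂ (fun w => (w - 1) * M w) (ball 1 ρ) := by
    refine DifferentiableOn.diffContOnCl fun w hw => ?_
    rw [closure_ball _ hρ.ne'] at hw
    exact ((differentiableAt_id.sub_const 1).mul (hM w hw).differentiableAt).differentiableWithinAt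
  have hfac : ∀ w ∈ sphere (1 : ℂ) ρ, 1 + z * kernel t w / (w - 1)
      = ((‖w - p‖ ^ 2 * ‖w - q‖ ^ 2 : ℝ) : ℂ) * ((w - 1) * M w) := by
    intro w hw
    have h1 := h w (sphere_subset_closedBall hw)
    have h2 := C.sub_one_ne_zero hw
    rw [C.defect_eq_sub_one_mul hw, blaschkeNum_eq_on_sphere hw, blaschkeNum_eq_on_sphere hw] at h1
    apply mul_left_cancel₀ h2
    rw [h1]
    push_cast
    ring
  have hre : ∀ w ∈ sphere (1 : ℂ) ρ, (1 + z * kernel t w / (w - 1)).re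
      = ‖w - p‖ ^ 2 * ‖w - q‖ ^ 2 * ((w - 1) * M w).re := fun w hw => by
    rw [hfac w hw, Complex.re_ofReal_mul]
  have hnn : ∀ w ∈ sphere (1 : ℂ) ρ, 0 ≤ ((w - 1) * M w).re := by
    refine re_nonneg_on_sphere_of_ne hρ (hcont.mono sphere_subset_closedBall) p q
      fun w hw hwp hwq => ?_
    have h5 := (abs_le.1 ((Complex.abs_re_le_norm _).trans (C.norm_mul_kernel_le hz hw))).1
    have h6 := hre w hw
    have h7 : 0 < ‖w - p‖ ^ 2 * ‖w - q‖ ^ 2 :=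
      mul_pos (pow_pos (norm_pos_iff.2 (sub_ne_zero.2 hwp)) 2)
        (pow_pos (norm_pos_iff.2 (sub_ne_zero.2 hwq)) 2)
    rw [Complex.add_re, Complex.one_re] at h6
    exact nonneg_of_mul_nonneg_right (by rw [← h6]; linarith) h7
  have hw : (1 + ρ : ℂ) ∈ sphere (1 : ℂ) ρ := by simp [abs_of_pos hρ]
  have h0 := re_eq_zero_of_re_nonneg_on_sphere hρ hV hnn (by simp) _ (sphere_subset_closedBall hw)
  have h1 := hre _ hw
  rw [h0, mul_zero, Complex.add_re, Complex.one_re] at h1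
  have h2 := C.norm_mul_kernel_le hz hw
  have h3 : 1 ≤ ‖z * kernel t (1 + ρ) / (1 + ρ - 1)‖ := by
    have := Complex.abs_re_le_norm (z * kernel t (1 + ρ) / (1 + ρ - 1))
    rw [show (z * kernel t (1 + ρ) / (1 + ρ - 1)).re = -1 by linarith] at this
    simpa using this
  -- the extremal case at `1 + ρ` would make `1 + ρ` a critical point
  have h4 : R * ‖kernel t (1 + ρ)‖ = ρ := by
    refine le_antisymm (C.norm_le _ hw) ?_
    have h5 : ‖(1 + ρ : ℂ) - 1‖ = ρ := by simp [abs_of_pos hρ]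
    rw [norm_div, h5, le_div_iff₀ hρ, one_mul, norm_mul] at h3
    exact h3.trans (by gcongr)
  have h5 := C.critical _ hw h4
  have h6 : t * (1 - (1 + ρ) ^ 2) = 1 := by exact_mod_cast h5
  nlinarith [mul_pos ht hρ, mul_pos (mul_pos ht hρ) hρ]

lemma root_unique (C : Contour t ρ R) (ht : 0 < t) {z p q : ℂ} (hz : ‖z‖ ≤ R)
    (hp : p ∈ closedBall (1 : ℂ) ρ) (hq : q ∈ closedBall (1 : ℂ) ρ)
    (hp0 : defect t z p = 0) (hq0 : defect t z q = 0) : p = q := by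
  by_contra hne
  have hρ := C.radius_pos
  obtain ⟨g, hg, hfg⟩ := exists_eq_blaschkeNum_mul hρ
    (fun w _ => (differentiable_defect t z).analyticAt w) hp hp0
    (fun h => C.deriv_defect_eq_zero hz h hp0)
  have hB := blaschkeNum_ne_zero hρ hp hq (Ne.symm hne)
  have hgq : g q = 0 := by
    have := (hfg q hq).self_of_nhds
    rw [hq0] at this
    exact (mul_eq_zero.1 this.symm).resolve_left hB
  obtain ⟨M, hM, hgM⟩ := exists_eq_blaschkeNum_mul hρ hg hq hgq fun h => by
    have h1 := C.deriv_defect_eq_zero hz h hq0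
    have h2 := ((differentiable_blaschkeNum (ρ := ρ) p q).hasDerivAt.mul
      (hg q hq).differentiableAt.hasDerivAt).deriv
    rw [(hfg q hq).deriv_eq] at h1
    rw [show (fun x => blaschkeNum ρ p x * g x) = blaschkeNum ρ p * g from rfl, h2, hgq, mul_zero,
      zero_add] at h1
    exact (mul_eq_zero.1 h1).resolve_left hB
  refine C.not_eq_mul_blaschkeNum ht hz (p := p) (q := q) hM fun w hw => ?_
  exact (hfg w hw).self_of_nhds.trans (congrArg _ (hgM w hw).self_of_nhds)

/-- A root inside the circle is simple. -/
lemma deriv_defect_ne_zero (C : Contour t ρ R) (ht : 0 < t) {z p : ℂ} (hz : ‖z‖ ≤ R)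
    (hp : p ∈ ball (1 : ℂ) ρ) (hp0 : defect t z p = 0) : deriv (defect t z) p ≠ 0 := by
  intro h1
  have hρ := C.radius_pos
  have hp' := ball_subset_closedBall hp
  have hs : p ∉ sphere (1 : ℂ) ρ := fun h => (mem_ball.1 hp).ne h
  obtain ⟨g, hg, hfg⟩ := exists_eq_blaschkeNum_mul hρ
    (fun w _ => (differentiable_defect t z).analyticAt w) hp' hp0 (fun h => absurd h hs)
  have hgp : g p = 0 := by
    have hB : HasDerivAt (blaschkeNum ρ p) ((ρ : ℂ) ^ 2 - (starRingEnd ℂ) (p - 1) * (p - 1)) p := by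
      have h3 : HasDerivAt (fun w : ℂ => (ρ : ℂ) ^ 2 - (starRingEnd ℂ) (p - 1) * (w - 1))
          (-((starRingEnd ℂ) (p - 1) * 1)) p :=
        (((hasDerivAt_id p).sub_const 1).const_mul _).const_sub _
      refine (((hasDerivAt_id p).sub_const p).mul h3).congr_deriv ?_
      simp
    have h2 := (hB.mul (hg p hp').differentiableAt.hasDerivAt).deriv
    rw [(hfg p hp').deriv_eq] at h1
    rw [show (fun x => blaschkeNum ρ p x * g x) = blaschkeNum ρ p * g from rfl, h2,
      show blaschkeNum ρ p p = 0 by simp [blaschkeNum], zero_mul, add_zero] at h1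
    exact (mul_eq_zero.1 h1).resolve_left
      (blaschkeNum_second_ne_zero hρ hp' hp' (Or.inl hp))
  obtain ⟨M, hM, hgM⟩ := exists_eq_blaschkeNum_mul hρ hg hp' hgp (fun h => absurd h hs)
  refine C.not_eq_mul_blaschkeNum ht hz (p := p) (q := p) hM fun w hw => ?_
  exact (hfg w hw).self_of_nhds.trans (congrArg _ (hgM w hw).self_of_nhds)

end Contour

/-! ### The branch and its regularity -/

/-- The map `w ↦ e^{2tw} (1 - w) / (1 + w)` that the function `r_t` inverts. -/
def cayleyExp (t : ℝ) (w : ℂ) : ℂ := Complex.exp (2 * t * w) * ((1 - w) / (1 + w))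

lemma defect_eq_zero_iff {z w : ℂ} (h : 1 + w ≠ 0) : defect t z w = 0 ↔ cayleyExp t w = z :=
  ⟨fun h' => (eq_exp_mul_of_defect h').symm, fun h' => defect_eq_zero_of_eq h h'.symm⟩

lemma hasDerivAt_cayleyExp {w : ℂ} (h : 1 + w ≠ 0) :
    HasDerivAt (cayleyExp t)
      (Complex.exp (2 * t * w) * (2 * (t * (1 - w ^ 2) - 1)) / (1 + w) ^ 2) w := by
  have h1 : HasDerivAt (fun w : ℂ => 2 * t * w) (2 * t) w := by
    simpa using (hasDerivAt_id w).const_mul (2 * (t : ℂ))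
  have h2 : HasDerivAt (fun w : ℂ => 1 + w) 1 w := by simpa using (hasDerivAt_id w).const_add 1
  have h3 : HasDerivAt (fun w : ℂ => 1 - w) (-1) w := by simpa using (hasDerivAt_id w).const_sub 1
  refine (h1.cexp.mul (h3.div h2 h)).congr_deriv ?_
  simp only [Pi.div_apply]
  field_simp
  ring

lemma analyticAt_cayleyExp {w : ℂ} (h : 1 + w ≠ 0) : AnalyticAt ℂ (cayleyExp t) w := by
  unfold cayleyExp
  fun_prop (disch := exact h)

/-- Implicit differentiation of the equation `defect t z (r z) = 0`. -/
lemma deriv_mul_deriv_defect {r : ℂ → ℂ} {z : ℂ} (hr : DifferentiableAt ℂ r z)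
    (he : ∀ᶠ x in 𝓝 z, defect t x (r x) = 0) :
    deriv r z * deriv (defect t z) (r z) = -kernel t (r z) := by
  have h1 := hr.hasDerivAt
  have h2 : HasDerivAt (fun z => defect t z (r z)) _ z :=
    (h1.sub_const 1).add ((hasDerivAt_id z).mul ((hasDerivAt_kernel t _).comp z h1))
  have h3 : HasDerivAt (fun z => defect t z (r z)) 0 z :=
    (hasDerivAt_const z (0 : ℂ)).congr_of_eventuallyEq he
  have h4 := h2.unique h3
  simp only [id] at h4
  rw [(hasDerivAt_defect t z _).deriv]
  linear_combination h4

/-- The differential equation `2 z r' (t (1 - r²) - 1) = 1 - r²` satisfied by solutions of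
`defect t z (r z) = 0`. -/
lemma two_mul_deriv_mul_eq {r : ℂ → ℂ} {z : ℂ} (hr : DifferentiableAt ℂ r z)
    (he : ∀ᶠ x in 𝓝 z, defect t x (r x) = 0) :
    2 * z * deriv r z * (t * (1 - r z ^ 2) - 1) = 1 - r z ^ 2 := by
  have h1 := deriv_mul_deriv_defect hr he
  have h2 := one_add_mul_deriv_defect he.self_of_nhds
  have h3 := he.self_of_nhds
  unfold defect at h3
  linear_combination z * deriv r z * h2 - z * (1 + r z) * h1 + (1 + r z) * h3

/-- A solution of `z = e^{2tw} (1 - w) / (1 + w)` in the closed disk `|w - 1| ≤ ρ`, if there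
is one. For suitable `ρ` this is the function `r_t`, together with its extensions. -/
def branch (t ρ : ℝ) (z : ℂ) : ℂ :=
  Classical.epsilon fun w => w ∈ closedBall (1 : ℂ) ρ ∧ defect t z w = 0

lemma branch_spec {z w : ℂ} (hw : w ∈ closedBall (1 : ℂ) ρ) (h : defect t z w = 0) :
    branch t ρ z ∈ closedBall (1 : ℂ) ρ ∧ defect t z (branch t ρ z) = 0 :=
  Classical.epsilon_spec (p := fun w => w ∈ closedBall (1 : ℂ) ρ ∧ defect t z w = 0) ⟨w, hw, h⟩

namespace Contour

lemma branch_mem (C : Contour t ρ R) {z : ℂ} (hz : ‖z‖ ≤ R) :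
    branch t ρ z ∈ closedBall (1 : ℂ) ρ :=
  let ⟨_, hw, h⟩ := C.exists_root hz
  (branch_spec hw h).1

lemma defect_branch (C : Contour t ρ R) {z : ℂ} (hz : ‖z‖ ≤ R) :
    defect t z (branch t ρ z) = 0 :=
  let ⟨_, hw, h⟩ := C.exists_root hz
  (branch_spec hw h).2

lemma branch_eq (C : Contour t ρ R) (ht : 0 < t) {z w : ℂ} (hz : ‖z‖ ≤ R)
    (hw : w ∈ closedBall (1 : ℂ) ρ) (h : defect t z w = 0) : branch t ρ z = w :=
  C.root_unique ht hz (C.branch_mem hz) hw (C.defect_branch hz) h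

lemma one_add_branch_ne_zero (C : Contour t ρ R) {z : ℂ} (hz : ‖z‖ ≤ R) :
    1 + branch t ρ z ≠ 0 := one_add_ne_zero_of_defect (C.defect_branch hz)

lemma cayleyExp_branch (C : Contour t ρ R) {z : ℂ} (hz : ‖z‖ ≤ R) :
    cayleyExp t (branch t ρ z) = z := (eq_exp_mul_of_defect (C.defect_branch hz)).symm

lemma branch_zero (C : Contour t ρ R) (ht : 0 < t) : branch t ρ 0 = 1 :=
  C.branch_eq ht (by simpa using zero_le_one.trans C.one_le) (by simp [C.radius_pos.le])
    (by simp [defect])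

/-- Compactness of the disk and uniqueness of the root give continuity of `branch`. -/
lemma tendsto_branch (C : Contour t ρ R) (ht : 0 < t) {z₀ : ℂ} (hz₀ : ‖z₀‖ ≤ R) {l : Filter ℂ}
    (hl : l ≤ 𝓝 z₀)
    (h : ∀ᶠ z in l, branch t ρ z ∈ closedBall (1 : ℂ) ρ ∧ defect t z (branch t ρ z) = 0) :
    Tendsto (branch t ρ) l (𝓝 (branch t ρ z₀)) := by
  refine (isCompact_closedBall (1 : ℂ) ρ).tendsto_nhds_of_unique_mapClusterPt
    (h.mono fun z hz => hz.1) fun w hw hcl => (C.branch_eq ht hz₀ hw ?_).symm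
  have h1 : MapClusterPt (z₀, w) l fun z => (z, branch t ρ z) := by
    rw [mapClusterPt_iff_frequently] at hcl ⊢
    intro s hs
    obtain ⟨u, hu, v, hv, huv⟩ := mem_nhds_prod_iff.1 hs
    exact ((hcl v hv).and_eventually (hl hu)).mono fun z hz => huv ⟨hz.2, hz.1⟩
  have hclosed : IsClosed {p : ℂ × ℂ | defect t p.1 p.2 = 0} :=
    isClosed_eq (continuous_defect t) continuous_const
  exact hclosed.mem_of_mapClusterPt h1 (h.mono fun z hz => hz.2)

lemma continuousOn_branch (C : Contour t ρ R) (ht : 0 < t) :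
    ContinuousOn (branch t ρ) (closedBall 0 R) := fun z₀ hz₀ =>
  C.tendsto_branch ht (by simpa using hz₀) nhdsWithin_le_nhds <| by
    filter_upwards [self_mem_nhdsWithin] with z hz
    have hz' : ‖z‖ ≤ R := by simpa using hz
    exact ⟨C.branch_mem hz', C.defect_branch hz'⟩

/-- Where the root lies inside the circle, `branch` is a local inverse of `cayleyExp t`. The
neighbourhood is a full one, also when `|z₀| = R`. -/
lemma eventually_branch (C : Contour t ρ R) (ht : 0 < t) {z₀ : ℂ} (hz₀ : ‖z₀‖ ≤ R)
    (hb : branch t ρ z₀ ∈ ball (1 : ℂ) ρ) :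
    AnalyticAt ℂ (branch t ρ) z₀ ∧ ∀ᶠ z in 𝓝 z₀, defect t z (branch t ρ z) = 0 := by
  set p := branch t ρ z₀ with hp
  have h1 : 1 + p ≠ 0 := C.one_add_branch_ne_zero hz₀
  have hΦ : AnalyticAt ℂ (cayleyExp t) p := analyticAt_cayleyExp h1
  have hΦp : cayleyExp t p = z₀ := C.cayleyExp_branch hz₀
  have hd : deriv (cayleyExp t) p ≠ 0 := by
    rw [(hasDerivAt_cayleyExp h1).deriv]
    have h2 := C.deriv_defect_ne_zero ht hz₀ hb (C.defect_branch hz₀)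
    rw [ne_eq, deriv_defect_eq_zero_iff (C.defect_branch hz₀)] at h2
    exact div_ne_zero (mul_ne_zero (Complex.exp_ne_zero _)
      (mul_ne_zero two_ne_zero (sub_ne_zero.2 h2))) (pow_ne_zero _ h1)
  set G := hΦ.hasStrictDerivAt.localInverse _ _ _ hd with hG
  have hGa : AnalyticAt ℂ G z₀ := hΦp ▸ hΦ.analyticAt_localInverse hd
  have hGp : G z₀ = p := hΦp ▸ HasStrictFDerivAt.localInverse_apply_image ..
  have hR : ∀ᶠ z in 𝓝 z₀, cayleyExp t (G z) = z :=
    hΦp ▸ HasStrictDerivAt.eventually_right_inverse ..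
  have hL : ∀ᶠ w in 𝓝 p, G (cayleyExp t w) = w := HasStrictFDerivAt.eventually_left_inverse ..
  have hGt : Tendsto G (𝓝 z₀) (𝓝 p) := hGp ▸ hGa.continuousAt
  have hroot : ∀ᶠ z in 𝓝 z₀,
      branch t ρ z ∈ closedBall (1 : ℂ) ρ ∧ defect t z (branch t ρ z) = 0 := by
    have e2 : ∀ᶠ z in 𝓝 z₀, 1 + G z ≠ 0 :=
      (hGt.const_add 1).eventually_ne h1
    filter_upwards [hR, hGt (isOpen_ball.mem_nhds hb), e2] with z hz hz1 hz2
    exact branch_spec (ball_subset_closedBall hz1) ((defect_eq_zero_iff hz2).2 hz)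
  have hbt : Tendsto (branch t ρ) (𝓝 z₀) (𝓝 p) := C.tendsto_branch ht hz₀ le_rfl hroot
  refine ⟨hGa.congr ?_, hroot.mono fun z hz => hz.2⟩
  filter_upwards [hroot, hbt hL] with z hz hz1
  have h3 := (eq_exp_mul_of_defect hz.2).symm
  rw [mem_preimage, mem_ofPred_eq] at hz1
  rw [← hz1]
  exact congrArg G h3.symm

lemma analyticAt_branch (C : Contour t ρ R) (ht : 0 < t) {z : ℂ} (hz : ‖z‖ ≤ R)
    (hb : branch t ρ z ∈ ball (1 : ℂ) ρ) : AnalyticAt ℂ (branch t ρ) z :=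
  (C.eventually_branch ht hz hb).1

/-- A root on the circle forces `|z| = R`. -/
lemma branch_mem_ball (C : Contour t ρ R) {z : ℂ} (hz : ‖z‖ < R) :
    branch t ρ z ∈ ball (1 : ℂ) ρ := by
  by_contra hb
  have h1 := C.branch_mem hz.le
  have hs : branch t ρ z ∈ sphere (1 : ℂ) ρ := by
    rw [mem_closedBall] at h1; rw [mem_ball, not_lt] at hb
    exact le_antisymm h1 hb
  have h2 := C.defect_branch hz.le
  have h3 : branch t ρ z - 1 = -(z * kernel t (branch t ρ z)) := by
    unfold defect at h2; linear_combination h2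
  have h4 : ρ = ‖z‖ * ‖kernel t (branch t ρ z)‖ := by
    rw [← norm_mul, ← norm_neg, ← h3]; simpa [dist_eq_norm] using hs.symm
  have h5 := C.norm_le _ hs
  have h6 := C.radius_pos
  rcases (norm_nonneg (kernel t (branch t ρ z))).eq_or_lt with h | h
  · rw [← h] at h4; linarith
  · nlinarith

lemma analyticOnNhd_branch (C : Contour t ρ R) (ht : 0 < t) :
    AnalyticOnNhd ℂ (branch t ρ) (ball 0 R) := fun z hz => by
  have hz' : ‖z‖ < R := by simpa using hz
  exact C.analyticAt_branch ht hz'.le (C.branch_mem_ball hz')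

lemma deriv_branch_mul (C : Contour t ρ R) (ht : 0 < t) {z : ℂ} (hz : ‖z‖ ≤ R)
    (hb : branch t ρ z ∈ ball (1 : ℂ) ρ) :
    deriv (branch t ρ) z * deriv (defect t z) (branch t ρ z) = -kernel t (branch t ρ z) :=
  let ⟨ha, he⟩ := C.eventually_branch ht hz hb
  deriv_mul_deriv_defect ha.differentiableAt he

end Contour

/-! ### Taylor coefficients as contour integrals -/

lemma hasSum_of_eq {f g : ℕ → ℂ} {a b : ℂ} (h : HasSum f a) (hf : ∀ n, g n = f n) (ha : b = a) :
    HasSum g b := by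
  rwa [funext hf, ha]

/-- The `n`-th Taylor coefficient of the series, the constant term `1` included. -/
def seriesCoeff (t : ℝ) (n : ℕ) : ℂ :=
  if n = 0 then 1 else
    2 * (((-1 : ℝ) ^ n / (n : ℝ) * Real.exp (-2 * (n : ℝ) * t) *
      (q (n - 1)).eval (-4 * (n : ℝ) * t) : ℝ) : ℂ)

lemma taylorPartialSum_eq (t : ℝ) (N : ℕ) (z : ℂ) :
    taylorPartialSum t N z = ∑ n ∈ Finset.range (N + 1), seriesCoeff t n * z ^ n := by
  rw [Finset.sum_range_succ', taylorPartialSum, Finset.range_eq_Ico,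
    Finset.sum_Ico_add' (fun n => seriesCoeff t n * z ^ n) 0 N 1, add_comm, Finset.mul_sum]
  congr 1
  · refine Finset.sum_congr (by ext; simp) fun n hn => ?_
    have : n ≠ 0 := by rw [Finset.mem_Ico] at hn; omega
    rw [seriesCoeff, if_neg this]; ring
  · simp [seriesCoeff]

lemma eval_q (m : ℕ) (x : ℝ) :
    (q m).eval x = ∑ j ∈ Finset.range (m + 1),
      ((m + 1).choose (j + 1) : ℝ) / (j.factorial : ℝ) * x ^ j := by
  simp [q, Polynomial.eval_finsetSum]

lemma degree_q (m : ℕ) : (q m).degree = (m : WithBot ℕ) := by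
  have hc : (q m).coeff m = 1 / (m.factorial : ℝ) := by
    simp [q, Polynomial.finsetSum_coeff, Polynomial.coeff_C_mul, Polynomial.coeff_X_pow]
  refine le_antisymm ?_ (Polynomial.le_degree_of_ne_zero ?_)
  · refine (Polynomial.degree_sum_le _ _).trans (Finset.sup_le fun j hj => ?_)
    refine (Polynomial.degree_C_mul_X_pow_le _ _).trans ?_
    have : j ≤ m := by rw [Finset.mem_range] at hj; omega
    exact_mod_cast this
  · rw [hc]; positivity

/-- The contour integral that represents the Taylor coefficients. -/
def contourCoeff (t ρ : ℝ) (n : ℕ) : ℂ :=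
  (2 * Real.pi * Complex.I)⁻¹ * ∮ w in C(1, ρ), (kernel t w / (w - 1)) ^ n

/-- Cauchy's formula turns the contour integral into a Taylor coefficient of
`(1 + w)^{n+1} e^{-2(n+1)tw}` at `1`, which Leibniz' rule evaluates. -/
lemma contourCoeff_succ (hρ : 0 < ρ) (t : ℝ) (n : ℕ) :
    contourCoeff t ρ (n + 1) =
      ((2 * Real.exp (-2 * ((n + 1 : ℕ) : ℝ) * t) *
        (q n).eval (-4 * ((n + 1 : ℕ) : ℝ) * t) : ℝ) : ℂ) := by
  set c : ℂ := -2 * ((n + 1 : ℕ) : ℂ) * t with hc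
  have hf : ∀ w, kernel t w ^ (n + 1) = (1 + w) ^ (n + 1) * Complex.exp (c * w) := fun w => by
    rw [kernel, mul_pow, ← Complex.exp_nat_mul]
    congr 2
    rw [hc]; ring
  have hderiv : iteratedDeriv n (fun w => kernel t w ^ (n + 1)) 1 =
      ∑ i ∈ Finset.range (n + 1), (n.choose i : ℂ) *
        (((n + 1).descFactorial i : ℂ) * 2 ^ (n + 1 - i)) * (c ^ (n - i) * Complex.exp c) := by
    simp_rw [hf]
    rw [iteratedDeriv_fun_mul (by fun_prop) (by fun_prop)]
    refine Finset.sum_congr rfl fun i _ => ?_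
    rw [iteratedDeriv_cexp_const_mul, iteratedDeriv_comp_const_add i (fun w : ℂ => w ^ (n + 1)) 1]
    simp only [iteratedDeriv_pow, mul_one]
    norm_num
  have hint : (∮ w in C(1, ρ), (kernel t w / (w - 1)) ^ (n + 1)) =
      (2 * Real.pi * Complex.I / n.factorial) *
        iteratedDeriv n (fun w => kernel t w ^ (n + 1)) 1 := by
    have h := DifferentiableOn.circleIntegral_one_div_sub_center_pow_smul (c := (1 : ℂ)) hρ n
      ((differentiable_kernel t).pow (n + 1)).differentiableOn
    rw [smul_eq_mul] at h
    refine Eq.trans ?_ h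
    congr 1
    ext w
    simp only [Pi.pow_apply, smul_eq_mul]
    rw [div_pow]
    ring
  rw [contourCoeff, hint, hderiv, eval_q, ← Finset.sum_range_reflect]
  have hpi : (2 * Real.pi * Complex.I : ℂ) ≠ 0 := Complex.two_pi_I_ne_zero
  rw [div_mul_eq_mul_div, mul_div_assoc, inv_mul_cancel_left₀ hpi, Finset.sum_div]
  push_cast
  rw [Finset.mul_sum]
  refine Finset.sum_congr rfl fun i hi => ?_
  have hi' : i ≤ n := by simp at hi; omega
  have hchoose : (n.choose i : ℂ) * ((n + 1).descFactorial (n - i) : ℂ) * (i.factorial : ℂ) =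
      ((n + 1).choose (i + 1) : ℂ) * (n.factorial : ℂ) := by
    have h1 := Nat.factorial_mul_descFactorial (show n - i ≤ n + 1 by omega)
    rw [show n + 1 - (n - i) = i + 1 by omega, Nat.factorial_succ, Nat.factorial_succ n] at h1
    have h2 := Nat.add_one_mul_choose_eq n i
    have h3 : (i + 1) * (n.choose i * (n + 1).descFactorial (n - i) * i.factorial) =
        (i + 1) * ((n + 1).choose (i + 1) * n.factorial) := by
      calc _ = n.choose i * ((i + 1) * i.factorial * (n + 1).descFactorial (n - i)) := by ring
        _ = (n + 1) * n.choose i * n.factorial := by rw [h1]; ring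
        _ = _ := by rw [h2]; ring
    exact_mod_cast Nat.eq_of_mul_eq_mul_left (Nat.succ_pos i) h3
  rw [Nat.choose_symm hi', show n - (n - i) = i by omega,
    show n + 1 - (n - i) = i + 1 by omega]
  have hn : (n.factorial : ℂ) ≠ 0 := by exact_mod_cast n.factorial_ne_zero
  have hi0 : (i.factorial : ℂ) ≠ 0 := by exact_mod_cast i.factorial_ne_zero
  have hexp : Complex.exp (-2 * ((n : ℂ) + 1) * t) = Complex.exp c := by rw [hc]; push_cast; rfl
  have hpow : (-4 * ((n : ℂ) + 1) * t) ^ i = 2 ^ i * c ^ i := by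
    rw [← mul_pow, hc]; push_cast; ring
  rw [hexp, hpow, div_eq_iff hn, pow_succ]
  have hx : (((n + 1).choose (i + 1) : ℂ)) / i.factorial * n.factorial =
      n.choose i * ((n + 1).descFactorial (n - i) : ℂ) := by
    rw [div_mul_eq_mul_div, ← hchoose]; field_simp
  linear_combination (-2 * Complex.exp c * 2 ^ i * c ^ i) * hx

lemma succ_mul_seriesCoeff (hρ : 0 < ρ) (t : ℝ) (n : ℕ) :
    ((n + 1 : ℕ) : ℂ) * seriesCoeff t (n + 1) = (-1) ^ (n + 1) * contourCoeff t ρ (n + 1) := by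
  rw [contourCoeff_succ hρ, seriesCoeff, if_neg n.succ_ne_zero]
  have : ((n + 1 : ℕ) : ℂ) ≠ 0 := by exact_mod_cast n.succ_ne_zero
  rw [Nat.add_sub_cancel]
  push_cast at this ⊢
  field_simp

namespace Contour

/-- The residue of `kernel / defect` at the root, in terms of the derivative of `branch`. -/
lemma circleIntegral_kernel_div_defect (C : Contour t ρ R) (ht : 0 < t) {z : ℂ} (hz : ‖z‖ < R) :
    (∮ w in C(1, ρ), kernel t w / defect t z w) =
      -(2 * Real.pi * Complex.I * deriv (branch t ρ) z) := by
  set p := branch t ρ z with hp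
  have hb := C.branch_mem_ball hz
  have h0 := C.defect_branch hz.le
  have hN := C.deriv_defect_ne_zero ht hz.le hb h0
  have hs : ∀ x, defect t z x = (x - p) * dslope (defect t z) p x := fun x => by
    have h7 := sub_smul_dslope (defect t z) p x
    rw [h0, sub_zero, smul_eq_mul] at h7
    exact h7.symm
  have hne : ∀ w ∈ closedBall (1 : ℂ) ρ, dslope (defect t z) p w ≠ 0 := fun w hw h => by
    rcases eq_or_ne w p with rfl | hwp
    · rw [dslope_same] at h; exact hN h
    · exact hwp (C.root_unique ht hz.le hw (C.branch_mem hz.le) (by rw [hs, h, mul_zero]) h0)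
  have hd : DifferentiableOn ℂ (fun w => kernel t w / dslope (defect t z) p w)
      (closedBall 1 ρ) := fun w hw =>
    ((differentiable_kernel t w).div (analyticOnNhd_dslope (S := univ)
      (fun w _ => (differentiable_defect t z).analyticAt w) (mem_univ p) w
      (mem_univ w)).differentiableAt (hne w hw)).differentiableWithinAt
  have h := hd.circleIntegral_sub_inv_smul hb
  simp only [smul_eq_mul] at h
  have h2 := C.deriv_branch_mul ht hz.le hb
  calc _ = ∮ w in C(1, ρ), (w - p)⁻¹ * (kernel t w / dslope (defect t z) p w) := by
        congr 1; ext w; rw [hs w, div_mul_eq_div_div, div_right_comm, div_eq_inv_mul _ (w - p)]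
    _ = _ := by
        rw [h, dslope_same, mul_div_assoc', div_eq_iff hN]
        linear_combination (2 * Real.pi * Complex.I) * h2

lemma norm_kernel_div_le (C : Contour t ρ R) {w : ℂ} (hw : w ∈ sphere (1 : ℂ) ρ) :
    R * ‖kernel t w / (w - 1)‖ ≤ 1 := by
  have hw' : ‖w - 1‖ = ρ := by simpa [dist_eq_norm] using hw
  rw [norm_div, hw', mul_div_assoc', div_le_one C.radius_pos]
  exact C.norm_le w hw

lemma continuous_integrand (C : Contour t ρ R) (n : ℕ) :
    Continuous fun θ => (kernel t (circleMap 1 ρ θ) / (circleMap 1 ρ θ - 1)) ^ n := by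
  have h1 : Continuous fun θ => kernel t (circleMap 1 ρ θ) :=
    (differentiable_kernel t).continuous.comp (continuous_circleMap 1 ρ)
  have h2 : Continuous fun θ => circleMap 1 ρ θ - 1 := (continuous_circleMap 1 ρ).sub
    continuous_const
  exact (h1.div h2 fun θ =>
    C.sub_one_ne_zero (circleMap_mem_sphere 1 C.radius_pos.le θ)).pow n

/-- The power series of the derivative of `branch`, by expanding `kernel / defect` into a
geometric series on the circle. -/
lemma hasSum_deriv_branch (C : Contour t ρ R) (ht : 0 < t) {z : ℂ} (hz : ‖z‖ < R) :
    HasSum (fun n : ℕ => z ^ n * (((n + 1 : ℕ) : ℂ) * seriesCoeff t (n + 1)))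
      (deriv (branch t ρ) z) := by
  have hR : 0 < R := zero_lt_one.trans_le C.one_le
  have hmem : ∀ θ, circleMap 1 ρ θ ∈ sphere (1 : ℂ) ρ := circleMap_mem_sphere 1 C.radius_pos.le
  set u : ℂ → ℂ := fun w => kernel t w / (w - 1) with hu
  have hu1 : ∀ w ∈ sphere (1 : ℂ) ρ, ‖u w‖ ≤ R⁻¹ := fun w hw => by
    have := C.norm_kernel_div_le hw
    rw [← one_div, le_div_iff₀' hR]; exact this
  have hlt : ‖z‖ * R⁻¹ < 1 := by rwa [← div_eq_mul_inv, div_lt_one hR]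
  have key : HasSum (fun n : ℕ => ∮ w in C(1, ρ), (-z) ^ n * u w ^ (n + 1))
      (∮ w in C(1, ρ), kernel t w / defect t z w) := by
    unfold circleIntegral
    refine intervalIntegral.hasSum_integral_of_dominated_convergence
      (fun n _ => ρ * ((‖z‖ * R⁻¹) ^ n * R⁻¹)) (fun n => ?_) (fun n => .of_forall fun θ _ => ?_)
      (.of_forall fun θ _ => ?_) ?_ (.of_forall fun θ _ => ?_)
    · have h1 := C.continuous_integrand (n + 1)
      have h2 : Continuous fun θ => deriv (circleMap 1 ρ) θ •
          ((-z) ^ n * u (circleMap 1 ρ θ) ^ (n + 1)) := by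
        simp only [deriv_circleMap]
        exact (((continuous_circleMap 0 ρ).mul continuous_const)).smul (continuous_const.mul h1)
      exact h2.aestronglyMeasurable
    · rw [norm_smul, deriv_circleMap, norm_mul, norm_circleMap_zero, Complex.norm_I, mul_one,
        abs_of_pos C.radius_pos, norm_mul, norm_pow, norm_pow, norm_neg, pow_succ ‖u _‖,
        mul_pow, mul_assoc (‖z‖ ^ n)]
      have := hu1 _ (hmem θ)
      have := C.radius_pos.le
      gcongr
    · exact ((summable_geometric_of_lt_one (by positivity) hlt).mul_right _).mul_left _
    · exact intervalIntegrable_const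
    · have hw := hmem θ
      have h1 := C.sub_one_ne_zero hw
      have h2 : ‖-z * u (circleMap 1 ρ θ)‖ < 1 := by
        rw [norm_mul, norm_neg]
        exact (mul_le_mul_of_nonneg_left (hu1 _ hw) (norm_nonneg z)).trans_lt hlt
      have h3 := ((hasSum_geometric_of_norm_lt_one h2).mul_right (u (circleMap 1 ρ θ))).const_smul
        (deriv (circleMap 1 ρ) θ)
      refine hasSum_of_eq h3 (fun n => ?_) ?_
      · simp only [smul_eq_mul]; ring
      · simp only []
        rw [C.defect_eq_sub_one_mul hw, ← mul_div_assoc', show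
          (1 + z * (kernel t (circleMap 1 ρ θ) / (circleMap 1 ρ θ - 1)))
            = 1 - -z * u (circleMap 1 ρ θ) by rw [hu]; ring]
        congr 1
        rw [hu, div_mul_eq_div_div]
        ring
  have h4 := key.mul_left (-(2 * Real.pi * Complex.I)⁻¹)
  rw [C.circleIntegral_kernel_div_defect ht hz] at h4
  refine hasSum_of_eq h4 (fun n => ?_) ?_
  · rw [succ_mul_seriesCoeff C.radius_pos, contourCoeff, circleIntegral.integral_const_mul, neg_pow]
    ring
  · have := Complex.two_pi_I_ne_zero
    field_simp

lemma hasSum_branch (C : Contour t ρ R) (ht : 0 < t) {z : ℂ} (hz : ‖z‖ < R) :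
    HasSum (fun n : ℕ => seriesCoeff t n * z ^ n) (branch t ρ z) := by
  have hR : 0 < R := zero_lt_one.trans_le C.one_le
  have hd := (C.analyticOnNhd_branch ht).differentiableOn
  have hd' : DifferentiableOn ℂ (deriv (branch t ρ)) (ball 0 R) := hd.deriv isOpen_ball
  have hco : ∀ n, (n.factorial : ℂ)⁻¹ * iteratedDeriv n (deriv (branch t ρ)) 0 =
      ((n + 1 : ℕ) : ℂ) * seriesCoeff t (n + 1) := by
    have h1 : HasFPowerSeriesAt (deriv (branch t ρ)) (FormalMultilinearSeries.ofScalars ℂ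
        fun n => (n.factorial : ℂ)⁻¹ * iteratedDeriv n (deriv (branch t ρ)) 0) 0 := by
      rw [hasFPowerSeriesAt_iff]
      filter_upwards [ball_mem_nhds 0 hR] with z hz
      refine hasSum_of_eq (Complex.hasSum_taylorSeries_on_ball hd' hz) (fun n => ?_) ?_
      · simp [FormalMultilinearSeries.coeff_ofScalars]; ring
      · simp
    have h2 : HasFPowerSeriesAt (deriv (branch t ρ)) (FormalMultilinearSeries.ofScalars ℂ
        fun n => ((n + 1 : ℕ) : ℂ) * seriesCoeff t (n + 1)) 0 := by
      rw [hasFPowerSeriesAt_iff]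
      filter_upwards [ball_mem_nhds 0 hR] with z hz
      refine hasSum_of_eq (C.hasSum_deriv_branch ht (z := z) (by simpa using hz)) (fun n => ?_) ?_
      · rw [FormalMultilinearSeries.coeff_ofScalars, smul_eq_mul]
      · simp
    intro n
    have := congrArg (fun p => FormalMultilinearSeries.coeff p n) (h1.eq_formalMultilinearSeries h2)
    simpa only [FormalMultilinearSeries.coeff_ofScalars] using this
  refine hasSum_of_eq (Complex.hasSum_taylorSeries_on_ball hd (z := z) (by simpa using hz))
    (fun n => ?_) rfl
  rw [sub_zero, smul_eq_mul, smul_eq_mul]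
  cases n with
  | zero => simp [seriesCoeff, C.branch_zero ht]
  | succ n =>
    have h := hco n
    rw [iteratedDeriv_succ', Nat.factorial_succ]
    have h1 : ((n + 1 : ℕ) : ℂ) ≠ 0 := by exact_mod_cast n.succ_ne_zero
    rw [Nat.cast_mul, mul_inv]
    apply mul_left_cancel₀ h1
    rw [← mul_assoc, ← h]
    field_simp

end Contour

/-! ### Uniform convergence and divergence of the series -/

/-- Tauber's theorem, uniformly on a closed disk: if `n aₙ Rⁿ → 0` and the sum of the power series
extends continuously to the closed disk of radius `R`, the series converges uniformly there. -/
lemma tendstoUniformlyOn_partialSum {a : ℕ → ℂ} {f : ℂ → ℂ} (hR : 0 < R)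
    (hf : ContinuousOn f (closedBall 0 R))
    (hs : ∀ z, ‖z‖ < R → HasSum (fun n => a n * z ^ n) (f z))
    (ha : Tendsto (fun n : ℕ => n * ‖a n‖ * R ^ n) atTop (𝓝 0)) :
    TendstoUniformlyOn (fun N z => ∑ n ∈ Finset.range (N + 1), a n * z ^ n) f atTop
      (closedBall 0 R) := by
  rw [Metric.tendstoUniformlyOn_iff]
  intro ε hε
  have hε3 : 0 < ε / 3 := by positivity
  have huc := (isCompact_closedBall (0 : ℂ) R).uniformContinuousOn_of_continuous hf
  obtain ⟨δ, hδ, hδf⟩ := Metric.uniformContinuousOn_iff.1 huc (ε / 3) hε3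
  have e1 : ∀ᶠ M : ℕ in atTop, (M : ℝ)⁻¹ * ∑ n ∈ Finset.range M, n * ‖a n‖ * R ^ n < ε / 3 :=
    ha.cesaro.eventually_lt_const hε3
  have e2 : ∀ᶠ M : ℕ in atTop, ∀ n ≥ M, n * ‖a n‖ * R ^ n ≤ ε / 3 :=
    eventually_forall_ge_atTop.2 (ha.eventually_le_const hε3)
  have e3 : ∀ᶠ M : ℕ in atTop, R / (M : ℝ) < δ :=
    (tendsto_const_div_atTop_nhds_zero_nat R).eventually_lt_const hδ
  filter_upwards [(tendsto_add_atTop_nat 1).eventually e1, (tendsto_add_atTop_nat 1).eventually e2,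
    (tendsto_add_atTop_nat 1).eventually e3] with N h1 h2 h3 z hz
  have hz' : ‖z‖ ≤ R := by simpa using hz
  set M := N + 1 with hM
  have hM0 : (0 : ℝ) < M := by rw [hM]; positivity
  have hM1 : (1 : ℝ) ≤ M := by rw [hM]; push_cast; linarith [N.cast_nonneg (α := ℝ)]
  -- compare the partial sum at `z` with the full sum at `(1 - 1/M) z`
  set l : ℝ := 1 - (M : ℝ)⁻¹ with hl
  have hMi : (M : ℝ)⁻¹ ≤ 1 := inv_le_one_of_one_le₀ hM1
  have hMp : 0 < (M : ℝ)⁻¹ := inv_pos.2 hM0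
  have hl0 : 0 ≤ l := by linarith
  have hl1 : l < 1 := by linarith
  have hnl : ‖(l : ℂ) * z‖ = l * ‖z‖ := by rw [norm_mul, Complex.norm_real, Real.norm_of_nonneg hl0]
  have hlz : ‖(l : ℂ) * z‖ < R := by
    rw [hnl]; nlinarith [norm_nonneg z]
  have hbound : ∀ n, ‖a n * z ^ n‖ ≤ ‖a n‖ * R ^ n := fun n => by
    rw [norm_mul, norm_pow]; gcongr
  have hA : ‖f (l * z) - f z‖ < ε / 3 := by
    rw [← dist_eq_norm]
    refine hδf _ (by simpa using hlz.le) _ hz ?_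
    rw [dist_eq_norm, show (l : ℂ) * z - z = -((((M : ℝ)⁻¹ : ℝ) : ℂ) * z) by
      rw [hl]; push_cast; ring, norm_neg, norm_mul, Complex.norm_real, Real.norm_of_nonneg hMp.le]
    refine lt_of_le_of_lt ?_ h3
    rw [div_eq_inv_mul]
    gcongr
  have hB : ‖∑ n ∈ Finset.range M, a n * z ^ n - ∑ n ∈ Finset.range M, a n * (l * z) ^ n‖
      < ε / 3 := by
    refine lt_of_le_of_lt ?_ h1
    rw [← Finset.sum_sub_distrib, Finset.mul_sum]
    refine (norm_sum_le _ _).trans (Finset.sum_le_sum fun n _ => ?_)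
    have h5 : a n * z ^ n - a n * (l * z) ^ n = a n * z ^ n * ((1 - l ^ n : ℝ) : ℂ) := by
      push_cast; ring
    have h6 : l ^ n ≤ 1 := pow_le_one₀ hl0 hl1.le
    have h7 : 1 - l ^ n ≤ n * (M : ℝ)⁻¹ := by
      have := one_add_mul_le_pow (a := -(M : ℝ)⁻¹) (by linarith) n
      rw [← sub_eq_add_neg 1, ← hl] at this
      linarith
    rw [h5, norm_mul, Complex.norm_real, Real.norm_of_nonneg (by linarith)]
    calc _ ≤ ‖a n‖ * R ^ n * (n * (M : ℝ)⁻¹) :=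
          mul_le_mul (hbound n) h7 (by linarith) (by positivity)
      _ = _ := by ring
  have hC : ‖f (l * z) - ∑ n ∈ Finset.range M, a n * (l * z) ^ n‖ ≤ ε / 3 := by
    have h5 := (hasSum_nat_add_iff' M).2 (hs _ hlz)
    have h6 : HasSum (fun n : ℕ => ε / 3 * (M : ℝ)⁻¹ * l ^ n) (ε / 3) := by
      have := (hasSum_geometric_of_lt_one hl0 hl1).mul_left (ε / 3 * (M : ℝ)⁻¹)
      rwa [show (1 - l)⁻¹ = (M : ℝ) by rw [hl]; simp, inv_mul_cancel_right₀ hM0.ne'] at this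
    refine h5.norm_le_of_bounded h6 fun n => ?_
    have h7 := h2 (n + M) (Nat.le_add_left _ _)
    have h8 : (M : ℝ) ≤ (n + M : ℕ) := by push_cast; linarith [n.cast_nonneg (α := ℝ)]
    have h9 : ‖a (n + M)‖ * R ^ (n + M) ≤ ε / 3 * (M : ℝ)⁻¹ := by
      rw [← div_eq_mul_inv, le_div_iff₀ hM0]
      calc _ = M * ‖a (n + M)‖ * R ^ (n + M) := by ring
        _ ≤ (n + M : ℕ) * ‖a (n + M)‖ * R ^ (n + M) := by gcongr
        _ ≤ _ := h7
    calc _ = ‖a (n + M) * z ^ (n + M)‖ * l ^ (n + M) := by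
          rw [mul_pow, norm_mul, norm_mul, norm_mul, norm_pow (l : ℂ), Complex.norm_real,
            Real.norm_of_nonneg hl0]; ring
      _ ≤ ‖a (n + M)‖ * R ^ (n + M) * l ^ n := by
          gcongr ?_ * ?_
          · exact hbound _
          · exact pow_le_pow_of_le_one hl0 hl1.le (Nat.le_add_right _ _)
      _ ≤ _ := by gcongr
  rw [dist_eq_norm, show f z - ∑ n ∈ Finset.range M, a n * z ^ n = -(f (l * z) - f z)
    - (∑ n ∈ Finset.range M, a n * z ^ n - ∑ n ∈ Finset.range M, a n * (l * z) ^ n)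
    + (f (l * z) - ∑ n ∈ Finset.range M, a n * (l * z) ^ n) by ring]
  calc _ ≤ ‖f (l * z) - f z‖ +
        ‖∑ n ∈ Finset.range M, a n * z ^ n - ∑ n ∈ Finset.range M, a n * (l * z) ^ n‖ +
        ‖f (l * z) - ∑ n ∈ Finset.range M, a n * (l * z) ^ n‖ := by
        refine (norm_add_le _ _).trans (add_le_add_left ((norm_sub_le _ _).trans ?_) _)
        rw [norm_neg]
    _ < ε := by linarith

namespace Contour

/-- The integrand of `contourCoeff`, scaled by `R`, has modulus below `1` off the finitely many
critical points on the circle, so the integrals of its powers tend to `0`. -/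
lemma tendsto_contourCoeff (C : Contour t ρ R) (ht : 0 < t) :
    Tendsto (fun n : ℕ => (R : ℂ) ^ n * contourCoeff t ρ n) atTop (𝓝 0) := by
  have hρ := C.radius_pos
  have hR : 0 < R := zero_lt_one.trans_le C.one_le
  have hmem : ∀ θ, circleMap 1 ρ θ ∈ sphere (1 : ℂ) ρ := circleMap_mem_sphere 1 hρ.le
  set v : ℝ → ℂ := fun θ => R * (kernel t (circleMap 1 ρ θ) / (circleMap 1 ρ θ - 1)) with hv
  have hnv : ∀ θ, ‖v θ‖ = R * ‖kernel t (circleMap 1 ρ θ) / (circleMap 1 ρ θ - 1)‖ := fun θ => by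
    rw [hv, norm_mul, Complex.norm_real, Real.norm_of_nonneg hR.le]
  have hv1 : ∀ θ, ‖v θ‖ ≤ 1 := fun θ => by rw [hnv]; exact C.norm_kernel_div_le (hmem θ)
  have hvc : ∀ n, Continuous fun θ => deriv (circleMap 1 ρ) θ • v θ ^ n := fun n => by
    have h1 := C.continuous_integrand 1
    simp only [pow_one] at h1
    simp only [deriv_circleMap]
    exact ((continuous_circleMap 0 ρ).mul continuous_const).smul
      ((continuous_const.mul h1).pow n)
  have hcrit : (circleMap 1 ρ ⁻¹' {w : ℂ | t * (1 - w ^ 2) = 1}).Countable := by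
    refine Countable.preimage_circleMap (Set.Finite.countable ?_) 1 hρ.ne'
    have ht' : (t : ℂ) ≠ 0 := by exact_mod_cast ht.ne'
    obtain ⟨s, hs⟩ := IsAlgClosed.exists_pow_nat_eq (1 - 1 / (t : ℂ)) (n := 2) two_pos
    refine (Set.toFinite {s, -s}).subset fun w hw => ?_
    rw [mem_ofPred_eq] at hw
    have h1 : w ^ 2 = s ^ 2 := by
      rw [hs]; field_simp; linear_combination -hw
    simpa using sq_eq_sq_iff_eq_or_eq_neg.1 h1
  have key : Tendsto (fun n : ℕ => ∫ θ in (0 : ℝ)..2 * Real.pi,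
      deriv (circleMap 1 ρ) θ • v θ ^ n) atTop (𝓝 (∫ _θ in (0 : ℝ)..2 * Real.pi, (0 : ℂ))) := by
    refine intervalIntegral.tendsto_integral_filter_of_dominated_convergence (fun _ => ρ)
      (.of_forall fun n => (hvc n).aestronglyMeasurable)
      (.of_forall fun n => .of_forall fun θ _ => ?_) intervalIntegrable_const ?_
    · rw [norm_smul, deriv_circleMap, norm_mul, norm_circleMap_zero, Complex.norm_I, mul_one,
        abs_of_pos hρ, norm_pow]
      exact mul_le_of_le_one_right hρ.le (pow_le_one₀ (norm_nonneg _) (hv1 θ))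
    · filter_upwards [hcrit.ae_notMem MeasureTheory.volume] with θ hθ _
      have h1 : ‖v θ‖ < 1 := by
        refine lt_of_le_of_ne (hv1 θ) fun h => hθ (C.critical _ (hmem θ) ?_)
        have hw' : ‖circleMap 1 ρ θ - 1‖ = ρ := by simpa [dist_eq_norm] using hmem θ
        rw [hnv, norm_div, hw', mul_div_assoc', div_eq_one_iff_eq hρ.ne'] at h
        exact h
      simpa using (tendsto_pow_atTop_nhds_zero_of_norm_lt_one h1).const_smul
        (deriv (circleMap 1 ρ) θ)
  have h2 := key.const_mul ((2 * Real.pi * Complex.I)⁻¹ : ℂ)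
  simp only [intervalIntegral.integral_zero, mul_zero] at h2
  refine h2.congr fun n => ?_
  rw [contourCoeff, mul_left_comm, ← circleIntegral.integral_const_mul]
  congr 1
  unfold circleIntegral
  congr 1
  ext θ
  rw [hv, mul_pow]

lemma tendsto_mul_norm_seriesCoeff (C : Contour t ρ R) (ht : 0 < t) :
    Tendsto (fun n : ℕ => n * ‖seriesCoeff t n‖ * R ^ n) atTop (𝓝 0) := by
  have hR : 0 < R := zero_lt_one.trans_le C.one_le
  rw [← tendsto_add_atTop_iff_nat 1]
  have h := ((tendsto_add_atTop_iff_nat 1).2 (C.tendsto_contourCoeff ht)).norm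
  rw [norm_zero] at h
  refine h.congr fun n => ?_
  have h1 := congrArg norm (succ_mul_seriesCoeff C.radius_pos t n)
  rw [norm_mul, norm_mul, norm_pow, norm_neg, norm_one, one_pow, one_mul, Complex.norm_natCast]
    at h1
  rw [norm_mul, ← h1, norm_pow, Complex.norm_real, Real.norm_of_nonneg hR.le]
  ring

lemma tendstoUniformlyOn_taylorPartialSum (C : Contour t ρ R) (ht : 0 < t) :
    TendstoUniformlyOn (taylorPartialSum t) (branch t ρ) atTop (closedBall 0 R) := by
  have hR : 0 < R := zero_lt_one.trans_le C.one_le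
  have h := tendstoUniformlyOn_partialSum hR (C.continuousOn_branch ht)
    (fun z hz => C.hasSum_branch ht hz) (C.tendsto_mul_norm_seriesCoeff ht)
  exact h.congr (.of_forall fun N z _ => (taylorPartialSum_eq t N z).symm)

/-- If a critical point `c` is a root for some `z₀` with `|z₀| = R`, the series diverges outside
the disk of radius `R`: otherwise its sum would be analytic at `z₀`, and differentiating
`defect t z (r z) = 0` there would give `kernel t c = 0`. -/
lemma not_tendsto_taylorPartialSum (C : Contour t ρ R) (ht : 0 < t) {z₀ : ℂ} (hz₀ : ‖z₀‖ = R)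
    (hc : t * (1 - branch t ρ z₀ ^ 2) = 1) {z : ℂ} (hz : R < ‖z‖) :
    ¬ ∃ w : ℂ, Tendsto (fun N : ℕ => taylorPartialSum t N z) atTop (𝓝 w) := by
  rintro ⟨w, hw⟩
  have hR : 0 < R := zero_lt_one.trans_le C.one_le
  have hterm : Tendsto (fun n => seriesCoeff t n * z ^ n) atTop (𝓝 0) := by
    rw [← tendsto_add_atTop_iff_nat 1]
    have h1 := ((tendsto_add_atTop_iff_nat 1).2 hw).sub hw
    rw [sub_self] at h1
    refine h1.congr fun N => ?_
    rw [taylorPartialSum_eq, taylorPartialSum_eq, Finset.sum_range_succ _ (N + 1)]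
    ring
  set P : FormalMultilinearSeries ℂ ℂ ℂ := FormalMultilinearSeries.ofScalars ℂ (seriesCoeff t)
    with hP
  have hrad : (‖z‖₊ : ENNReal) ≤ P.radius := by
    refine P.le_radius_of_tendsto (l := 0) ?_
    have h2 := hterm.norm
    rw [norm_zero] at h2
    refine h2.congr fun n => ?_
    rw [hP, FormalMultilinearSeries.ofScalars_norm, norm_mul, norm_pow, coe_nnnorm]
  have hz0 : (0 : ENNReal) < ‖z‖₊ := by
    rw [ENNReal.coe_pos, nnnorm_pos, ← norm_pos_iff]; linarith
  have hball := (P.hasFPowerSeriesOnBall (hz0.trans_le hrad)).mono hz0 hrad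
  set g := P.sum with hg
  have hgan : AnalyticOnNhd ℂ g (ball 0 ‖z‖) := by
    have := hball.analyticOnNhd
    rwa [Metric.eball_coe, coe_nnnorm] at this
  have hgr : ∀ x, ‖x‖ < R → g x = branch t ρ x := fun x hx => by
    have h3 := hball.hasSum (y := x) (by
      rw [Metric.eball_coe, coe_nnnorm]; simpa using hx.trans hz)
    rw [zero_add] at h3
    refine h3.unique (hasSum_of_eq (C.hasSum_branch ht hx) (fun n => ?_) rfl)
    rw [hP, FormalMultilinearSeries.ofScalars_apply_eq]; simp
  have hz₀z : z₀ ∈ ball (0 : ℂ) ‖z‖ := by simpa [hz₀] using hz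
  -- the value of the sum at `z₀` is the limit of `branch` from inside the disk
  have hval : g z₀ = branch t ρ z₀ := by
    have hne : (𝓝[ball (0 : ℂ) R] z₀).NeBot := by
      rw [← mem_closure_iff_nhdsWithin_neBot, closure_ball _ hR.ne']
      simp [hz₀]
    have h4 : Tendsto g (𝓝[ball (0 : ℂ) R] z₀) (𝓝 (g z₀)) :=
      (hgan z₀ hz₀z).continuousAt.mono_left nhdsWithin_le_nhds
    have h5 : Tendsto (branch t ρ) (𝓝[ball (0 : ℂ) R] z₀) (𝓝 (branch t ρ z₀)) :=
      (C.continuousOn_branch ht z₀ (by simp [hz₀])).mono_left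
        (nhdsWithin_mono _ ball_subset_closedBall)
    refine tendsto_nhds_unique (h4.congr' ?_) h5
    filter_upwards [self_mem_nhdsWithin] with x hx
    exact hgr x (by simpa using hx)
  have hD : AnalyticOnNhd ℂ (fun x => defect t x (g x)) (ball 0 ‖z‖) := fun x hx => by
    have hgx := hgan x hx
    have hk : AnalyticAt ℂ (fun x => kernel t (g x)) x :=
      ((differentiable_kernel t).analyticAt _).comp hgx
    exact (hgx.sub analyticAt_const).add (analyticAt_id.mul hk)
  have hD0 : EqOn (fun x => defect t x (g x)) 0 (ball 0 ‖z‖) := by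
    refine hD.eqOn_of_preconnected_of_eventuallyEq analyticOnNhd_const
      (convex_ball _ _).isPreconnected (z₀ := 0) (by simpa using hR.trans hz) ?_
    filter_upwards [ball_mem_nhds (0 : ℂ) hR] with x hx
    have hx' : ‖x‖ < R := by simpa using hx
    rw [hgr x hx', C.defect_branch hx'.le]; rfl
  have h4 := deriv_mul_deriv_defect (hgan z₀ hz₀z).differentiableAt
    (hD0.eventuallyEq_of_mem (isOpen_ball.mem_nhds hz₀z))
  have h5 := C.defect_branch hz₀.le
  have h7 : kernel t (branch t ρ z₀) = 0 := by
    rw [hval, (deriv_defect_eq_zero_iff h5).2 hc, mul_zero, eq_comm, neg_eq_zero] at h4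
    exact h4
  rw [kernel, mul_eq_zero] at h7
  exact h7.elim (one_add_ne_zero_of_defect h5) (Complex.exp_ne_zero _)

end Contour

/-! ### Local roots at critical points -/

/-- A function with a zero of order `k` is locally the `k`-th power of a local coordinate. The
hypothesis is on the derivative, whose leading coefficient `H c` determines that of `h`. -/
lemma exists_local_root {h H : ℂ → ℂ} {c : ℂ} {k : ℕ} (hk : k ≠ 0) (hh : AnalyticAt ℂ h c)
    (h0 : h c = 0) (hH : AnalyticAt ℂ H c) (hHc : H c ≠ 0)
    (hd : ∀ᶠ w in 𝓝 c, deriv h w = (w - c) ^ (k - 1) * H w) :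
    ∃ σ ψ : ℂ → ℂ, AnalyticAt ℂ σ c ∧ AnalyticAt ℂ ψ 0 ∧ ψ 0 = c ∧
      deriv ψ 0 ^ k = k / H c ∧ ∀ᶠ w in 𝓝 c, σ w ^ k = h w ∧ ψ (σ w) = w := by
  have hord : analyticOrderAt h c = k := by
    have h1 : analyticOrderAt (deriv h) c = (k - 1 : ℕ) :=
      hh.deriv.analyticOrderAt_eq_natCast.2 ⟨H, hH, hHc, hd⟩
    have h2 := hh.analyticOrderAt_deriv_add_one
    simp only [h0, sub_zero, h1] at h2
    rw [← h2]
    exact_mod_cast Nat.sub_add_cancel (Nat.one_le_iff_ne_zero.2 hk)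
  obtain ⟨G, hG, hGc, hhG⟩ := hh.analyticOrderAt_eq_natCast.1 hord
  simp only [smul_eq_mul] at hhG
  have hk' : (k : ℂ) ≠ 0 := by exact_mod_cast hk
  have hlead : k * G c = H c := by
    have h1 : ∀ᶠ w in 𝓝[≠] c, k * G w + (w - c) * deriv G w = H w := by
      have hev : ∀ᶠ w in 𝓝 c, h =ᶠ[𝓝 w] fun w => (w - c) ^ k * G w :=
        eventually_eventually_nhds.2 hhG
      filter_upwards [nhdsWithin_le_nhds hev, nhdsWithin_le_nhds hd,
        nhdsWithin_le_nhds hG.eventually_analyticAt, self_mem_nhdsWithin] with w hw1 hw2 hw3 hw4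
      have hp : HasDerivAt (fun w : ℂ => (w - c) ^ k) (k * (w - c) ^ (k - 1) * 1) w :=
        ((hasDerivAt_id w).sub_const c).pow k
      have h3 := (hp.mul hw3.differentiableAt.hasDerivAt).deriv
      rw [hw1.deriv_eq, show (fun w => (w - c) ^ k * G w) = (fun w => (w - c) ^ k) * G from rfl,
        h3] at hw2
      have hne : (w - c) ^ (k - 1) ≠ 0 := pow_ne_zero _ (sub_ne_zero.2 hw4)
      apply mul_left_cancel₀ hne
      rw [← hw2]
      have : (w - c) ^ k = (w - c) ^ (k - 1) * (w - c) := by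
        rw [← pow_succ, Nat.sub_add_cancel (Nat.one_le_iff_ne_zero.2 hk)]
      rw [this]
      ring
    have hc1 : ContinuousAt (fun w => k * G w + (w - c) * deriv G w) c :=
      (continuousAt_const.mul hG.continuousAt).add
        ((continuousAt_id.sub continuousAt_const).mul hG.deriv.continuousAt)
    have h2 := tendsto_nhds_unique ((hc1.tendsto.mono_left nhdsWithin_le_nhds).congr' h1)
      (hH.continuousAt.tendsto.mono_left nhdsWithin_le_nhds)
    simpa using h2
  obtain ⟨κ, hκ⟩ := IsAlgClosed.exists_pow_nat_eq (G c) (Nat.pos_of_ne_zero hk)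
  have hκ0 : κ ≠ 0 := fun h => hGc (by rw [← hκ, h, zero_pow hk])
  set E : ℂ → ℂ := fun w => κ * (G w / G c) ^ ((k : ℂ)⁻¹) with hE
  have hEa : AnalyticAt ℂ E c := by
    refine analyticAt_const.mul ((hG.div analyticAt_const hGc).cpow analyticAt_const ?_)
    rw [Pi.div_apply, div_self hGc]
    exact Complex.one_mem_slitPlane
  have hEc : E c = κ := by simp [hE, div_self hGc]
  have hEk : ∀ w, E w ^ k = G w := fun w => by
    rw [hE, mul_pow, hκ, Complex.cpow_nat_inv_pow _ hk, mul_div_cancel₀ _ hGc]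
  set σ : ℂ → ℂ := fun w => (w - c) * E w with hσ
  have hσa : AnalyticAt ℂ σ c := (analyticAt_id.sub analyticAt_const).mul hEa
  have hσc : σ c = 0 := by simp [hσ]
  have hσd : deriv σ c = κ := by
    have h1 := (((hasDerivAt_id c).sub_const c).mul hEa.differentiableAt.hasDerivAt).deriv
    rw [show σ = (fun w => id w - c) * E from rfl, h1]
    simp [hEc]
  have hσd0 : deriv σ c ≠ 0 := hσd ▸ hκ0
  set ψ := hσa.hasStrictDerivAt.localInverse _ _ _ hσd0 with hψ
  refine ⟨σ, ψ, hσa, hσc ▸ hσa.analyticAt_localInverse hσd0,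
    hσc ▸ HasStrictFDerivAt.localInverse_apply_image .., ?_, ?_⟩
  · have h1 : HasStrictDerivAt ψ (deriv σ c)⁻¹ (σ c) :=
      hσa.hasStrictDerivAt.to_localInverse hσd0
    rw [hσc] at h1
    rw [h1.hasDerivAt.deriv, hσd, inv_pow, hκ, ← hlead]
    field_simp
  · have hL : ∀ᶠ w in 𝓝 c, ψ (σ w) = w := HasStrictFDerivAt.eventually_left_inverse ..
    filter_upwards [hhG, hL] with w hw1 hw2
    exact ⟨by rw [hσ, mul_pow, hEk, hw1], hw2⟩

/-- The principal branch of `(1 - z / z₀)^{1/k}`. -/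
def rootBranch (z₀ : ℂ) (k : ℕ) (z : ℂ) : ℂ := (1 - z / z₀) ^ ((k : ℂ)⁻¹)

lemma rootBranch_pow (z₀ : ℂ) {k : ℕ} (hk : k ≠ 0) (z : ℂ) :
    rootBranch z₀ k z ^ k = 1 - z / z₀ := Complex.cpow_nat_inv_pow _ hk

lemma continuousOn_rootBranch {z₀ : ℂ} (hz₀ : ‖z₀‖ = 1) {k : ℕ} (hk : k ≠ 0) :
    ContinuousOn (rootBranch z₀ k) (closedBall 0 1) := by
  intro z hz
  have hz' : ‖z‖ ≤ 1 := by simpa using hz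
  have h1 : ContinuousAt (fun x : ℂ => x ^ ((k : ℂ)⁻¹)) (1 - z / z₀) := by
    refine Complex.continuousAt_cpow_const_of_re_pos (Or.inl ?_) ?_
    · have h2 : (z / z₀).re ≤ 1 := (Complex.re_le_norm _).trans (by rw [norm_div, hz₀, div_one]; exact hz')
      simpa using h2
    · have : ((k : ℂ)⁻¹) = (((k : ℝ)⁻¹ : ℝ) : ℂ) := by push_cast; rfl
      rw [this, Complex.ofReal_re]
      exact inv_pos.2 (by exact_mod_cast Nat.pos_of_ne_zero hk)
  exact (ContinuousAt.comp (f := fun z : ℂ => 1 - z / z₀) h1 (by fun_prop)).continuousWithinAt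

/-- Two continuous functions with equal `k`-th powers on the closed unit disk near a boundary
point `z₀`, nonzero off `z₀`, differ by a constant root of unity. -/
lemma exists_root_of_unity {f g : ℂ → ℂ} {z₀ : ℂ} {ε : ℝ} (hz₀ : ‖z₀‖ = 1) {k : ℕ} (hk : k ≠ 0)
    (hf : ContinuousOn f (closedBall 0 1 ∩ ball z₀ ε))
    (hg : ContinuousOn g (closedBall 0 1 ∩ ball z₀ ε))
    (hfg : ∀ z ∈ closedBall (0 : ℂ) 1 ∩ ball z₀ ε, f z ^ k = g z ^ k)
    (hg0 : ∀ z, z ≠ z₀ → g z ≠ 0) (hz₀g : g z₀ = 0) :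
    ∃ ω : ℂ, ω ^ k = 1 ∧ ∀ z ∈ closedBall (0 : ℂ) 1 ∩ ball z₀ ε, f z = ω * g z := by
  have hz0 : z₀ ≠ 0 := fun h => by simp [h] at hz₀
  -- removing the boundary point amounts to intersecting with an open half-plane
  set S : Set ℂ := (closedBall 0 1 ∩ ball z₀ ε) ∩ {z | (z / z₀).re < 1} with hS
  have hconv : Convex ℝ S := by
    refine ((convex_closedBall _ _).inter (convex_ball _ _)).inter ?_
    have : IsLinearMap ℝ fun z : ℂ => (z / z₀).re :=
      ⟨fun x y => by rw [add_div, Complex.add_re],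
        fun c x => by rw [Complex.real_smul, mul_div_assoc, Complex.re_ofReal_mul, smul_eq_mul]⟩
    exact convex_halfSpace_lt this 1
  have hmemS : ∀ z ∈ closedBall (0 : ℂ) 1 ∩ ball z₀ ε, z ≠ z₀ → z ∈ S := by
    intro z hz hne
    have hz' : ‖z‖ ≤ 1 := by simpa using hz.1
    have hn : ‖z / z₀‖ ≤ 1 := by rw [norm_div, hz₀, div_one]; exact hz'
    refine ⟨hz, lt_of_le_of_ne ((Complex.re_le_norm _).trans hn) fun h => hne ?_⟩
    have h8 : (z / z₀).re * (z / z₀).re + (z / z₀).im * (z / z₀).im ≤ 1 := by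
      rw [← Complex.normSq_apply, Complex.normSq_eq_norm_sq]
      exact pow_le_one₀ (norm_nonneg _) hn
    have h9 : (z / z₀).im = 0 := by rw [h] at h8; nlinarith [mul_self_nonneg (z / z₀).im]
    have h10 : z / z₀ = 1 := Complex.ext (by simp [h]) (by simp [h9])
    exact (div_eq_one_iff_eq hz0).1 h10
  have hSne : ∀ z ∈ S, z ≠ z₀ := fun z hz h => by
    have := hz.2; rw [mem_ofPred_eq, h, div_self hz0] at this; simp at this
  have hT : {x : ℂ | x ^ k = 1}.Finite := by
    refine (Polynomial.nthRoots k (1 : ℂ)).toFinset.finite_toSet.subset fun x hx => ?_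
    simpa [Polynomial.mem_nthRoots (Nat.pos_of_ne_zero hk)] using hx
  have hfz₀ : ∀ ω : ℂ, z₀ ∈ closedBall (0 : ℂ) 1 ∩ ball z₀ ε → f z₀ = ω * g z₀ := fun ω h => by
    have h1 := hfg z₀ h
    rw [hz₀g, zero_pow hk, pow_eq_zero_iff hk] at h1
    rw [h1, hz₀g, mul_zero]
  rcases S.eq_empty_or_nonempty with hE | ⟨x, hx⟩
  · refine ⟨1, one_pow _, fun z hz => ?_⟩
    rcases eq_or_ne z z₀ with rfl | hne
    · exact hfz₀ _ hz
    · exact absurd (hmemS z hz hne) (by simp [hE])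
  · have hmaps : MapsTo (fun z => f z / g z) S {x : ℂ | x ^ k = 1} := fun z hz => by
      rw [mem_ofPred_eq, div_pow, hfg z hz.1, div_self (pow_ne_zero _ (hg0 z (hSne z hz)))]
    have hcont : ContinuousOn (fun z => f z / g z) S :=
      (hf.mono inter_subset_left).div (hg.mono inter_subset_left) fun z hz => hg0 z (hSne z hz)
    refine ⟨f x / g x, hmaps hx, fun z hz => ?_⟩
    rcases eq_or_ne z z₀ with rfl | hne
    · exact hfz₀ _ hz
    · have h1 := hconv.isPreconnected.constant_of_mapsTo hT.isDiscrete hcont hmaps (hmemS z hz hne) hx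
      rw [← h1, div_mul_cancel₀ _ (hg0 z hne)]

/-- At a boundary point whose root `c` is a zero of order `k - 1` of the derivative of
`cayleyExp t`, the function `branch` is analytic in the principal `k`-th root of `1 - z / z₀`. -/
lemma Contour.exists_eq_comp_rootBranch (C : Contour t ρ 1) (ht : 0 < t) {z₀ : ℂ} (hz₀ : ‖z₀‖ = 1)
    {k : ℕ} (hk : k ≠ 0) {H : ℂ → ℂ} (hH : AnalyticAt ℂ H (branch t ρ z₀))
    (hHc : H (branch t ρ z₀) ≠ 0)
    (hd : ∀ᶠ w in 𝓝 (branch t ρ z₀),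
      deriv (cayleyExp t) w = (w - branch t ρ z₀) ^ (k - 1) * H w) :
    ∃ ψ : ℂ → ℂ, AnalyticAt ℂ ψ 0 ∧ ψ 0 = branch t ρ z₀ ∧
      deriv ψ 0 ^ k = -(k * z₀ / H (branch t ρ z₀)) ∧
      ∀ᶠ z in 𝓝[closedBall (0 : ℂ) 1] z₀, branch t ρ z = ψ (rootBranch z₀ k z) := by
  have hz0 : z₀ ≠ 0 := fun h => by simp [h] at hz₀
  set c := branch t ρ z₀ with hc
  have hmem : z₀ ∈ closedBall (0 : ℂ) 1 := by simp [hz₀]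
  have h1c : 1 + c ≠ 0 := C.one_add_branch_ne_zero hz₀.le
  have hΦ : AnalyticAt ℂ (cayleyExp t) c := analyticAt_cayleyExp h1c
  obtain ⟨σ, ψ, hσ, hψ, hψ0, hψd, hσψ⟩ := exists_local_root (c := c) (k := k)
    (h := fun w => 1 - cayleyExp t w / z₀) (H := fun w => -(H w / z₀)) hk
    (analyticAt_const.sub (hΦ.div analyticAt_const hz0))
    (by rw [hc, C.cayleyExp_branch hz₀.le, div_self hz0, sub_self])
    (hH.div analyticAt_const hz0).neg (neg_ne_zero.2 (div_ne_zero hHc hz0)) (by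
      filter_upwards [hd, hΦ.eventually_analyticAt] with w hw hw2
      rw [deriv_const_sub, deriv_div_const, hw]
      ring)
  have hrt : Tendsto (branch t ρ) (𝓝[closedBall 0 1] z₀) (𝓝 c) := C.continuousOn_branch ht z₀ hmem
  obtain ⟨ε, hε, hεP⟩ := Metric.mem_nhdsWithin_iff.1
    (hrt.eventually (hσψ.and hσ.eventually_continuousAt))
  have hP : ∀ z ∈ closedBall (0 : ℂ) 1 ∩ ball z₀ ε,
      (σ (branch t ρ z) ^ k = 1 - z / z₀ ∧ ψ (σ (branch t ρ z)) = branch t ρ z) ∧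
        ContinuousAt σ (branch t ρ z) := fun z hz => by
    have h2 := hεP ⟨hz.2, hz.1⟩
    rwa [mem_ofPred_eq, C.cayleyExp_branch (by simpa using hz.1)] at h2
  have hβ0 : ∀ z, z ≠ z₀ → rootBranch z₀ k z ≠ 0 := fun z hz h => hz (by
    have := rootBranch_pow z₀ hk z
    rw [h, zero_pow hk, eq_comm, sub_eq_zero, eq_comm, div_eq_one_iff_eq hz0] at this
    exact this)
  have hβz₀ : rootBranch z₀ k z₀ = 0 := by
    have := rootBranch_pow z₀ hk z₀
    rwa [div_self hz0, sub_self, pow_eq_zero_iff hk] at this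
  obtain ⟨ω, hω, hωe⟩ := exists_root_of_unity (f := fun z => σ (branch t ρ z))
    (g := rootBranch z₀ k) (ε := ε) hz₀ hk
    (fun z hz => (hP z hz).2.comp_continuousWithinAt
      ((C.continuousOn_branch ht z hz.1).mono inter_subset_left))
    ((continuousOn_rootBranch hz₀ hk).mono inter_subset_left)
    (fun z hz => by rw [(hP z hz).1.1, rootBranch_pow z₀ hk]) hβ0 hβz₀
  have hψ' : HasDerivAt (fun s => ψ (ω * s)) (deriv ψ 0 * ω) 0 := by
    have h2 : HasDerivAt (fun s : ℂ => ω * s) ω 0 := by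
      simpa using (hasDerivAt_id (0 : ℂ)).const_mul ω
    have h3 : HasDerivAt ψ (deriv ψ 0) (ω * 0) := by
      rw [mul_zero]; exact hψ.differentiableAt.hasDerivAt
    exact h3.comp 0 h2
  refine ⟨fun s => ψ (ω * s), ?_, by simpa using hψ0, ?_, ?_⟩
  · refine AnalyticAt.comp (f := fun s => ω * s) ?_ (by fun_prop)
    rwa [mul_zero]
  · rw [hψ'.deriv, mul_pow, hω, mul_one, hψd]
    field_simp
  · filter_upwards [self_mem_nhdsWithin, nhdsWithin_le_nhds (ball_mem_nhds z₀ hε)] with z hz1 hz2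
    rw [← hωe z ⟨hz1, hz2⟩, (hP z ⟨hz1, hz2⟩).1.2]

/-- An analytic function of a continuous `s` vanishing at `z₀` is a convergent series in `s`. -/
lemma eventually_hasSum_of_analyticAt {ψ s : ℂ → ℂ} (hψ : AnalyticAt ℂ ψ 0) {l : Filter ℂ}
    (hs : Tendsto s l (𝓝 0)) :
    ∃ a : ℕ → ℂ, a 0 = ψ 0 ∧ a 1 = deriv ψ 0 ∧
      ∀ᶠ z in l, HasSum (fun n => a n * s z ^ n) (ψ (s z)) := by
  obtain ⟨p, hp⟩ := hψ
  refine ⟨p.coeff, ?_, hp.deriv.symm, ?_⟩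
  · rw [FormalMultilinearSeries.coeff]; exact hp.coeff_zero _
  · filter_upwards [hs.eventually (hasFPowerSeriesAt_iff.1 hp)] with z hz
    rw [zero_add] at hz
    exact hasSum_of_eq hz (fun n => by rw [smul_eq_mul, mul_comm]) rfl

/-! ### The principal branch in the half-plane; the real axis -/

lemma two_mul_exp_mul_cos (x : ℂ) :
    2 * Complex.exp (Complex.I * x) * Complex.cos x = 1 + Complex.exp (2 * Complex.I * x) := by
  have h1 : Complex.exp (2 * Complex.I * x) =
      Complex.exp (Complex.I * x) * Complex.exp (Complex.I * x) := by
    rw [← Complex.exp_add]; congr 1; ring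
  have h2 : Complex.exp (Complex.I * x) * Complex.exp (-(Complex.I * x)) = 1 := by
    rw [← Complex.exp_add]; simp
  rw [Complex.cos, h1, show x * Complex.I = Complex.I * x by ring,
    show -x * Complex.I = -(Complex.I * x) by ring]
  linear_combination h2

lemma two_mul_exp_mul_sin (x : ℂ) :
    2 * Complex.exp (Complex.I * x) * Complex.sin x =
      Complex.I * (1 - Complex.exp (2 * Complex.I * x)) := by
  have h1 : Complex.exp (2 * Complex.I * x) =
      Complex.exp (Complex.I * x) * Complex.exp (Complex.I * x) := by
    rw [← Complex.exp_add]; congr 1; ring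
  have h2 : Complex.exp (Complex.I * x) * Complex.exp (-(Complex.I * x)) = 1 := by
    rw [← Complex.exp_add]; simp
  rw [Complex.sin, h1, show x * Complex.I = Complex.I * x by ring,
    show -x * Complex.I = -(Complex.I * x) by ring]
  linear_combination Complex.I * h2

/-- With `z = e^{2iθ}` and `ζ = θ + i t s`, the equation `tan ζ = i s` is `defect t z s = 0`. -/
lemma defect_eq_zero_iff_sin (θ s : ℂ) :
    defect t (Complex.exp (2 * Complex.I * θ)) s = 0 ↔
      Complex.sin (θ + Complex.I * t * s) = Complex.I * s * Complex.cos (θ + Complex.I * t * s) := by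
  set x := θ + Complex.I * t * s with hx
  have hE : Complex.exp (2 * Complex.I * θ) * Complex.exp (-(2 * t * s)) =
      Complex.exp (2 * Complex.I * x) := by
    rw [← Complex.exp_add, hx]
    congr 1
    linear_combination -2 * t * s * Complex.I_sq
  have h0 : (2 * Complex.exp (Complex.I * x)) ≠ 0 :=
    mul_ne_zero two_ne_zero (Complex.exp_ne_zero _)
  have h1 := two_mul_exp_mul_cos x
  have h2 := two_mul_exp_mul_sin x
  rw [← mul_right_inj' h0 (b := Complex.sin x), h2, show 2 * Complex.exp (Complex.I * x) *
    (Complex.I * s * Complex.cos x) = Complex.I * (s * (2 * Complex.exp (Complex.I * x) *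
      Complex.cos x)) by ring, h1, mul_right_inj' Complex.I_ne_zero, ← hE]
  unfold defect kernel
  constructor <;> intro h <;> linear_combination -h

lemma norm_exp_two_I_mul (θ : ℂ) :
    ‖Complex.exp (2 * Complex.I * θ)‖ = Real.exp (-2 * θ.im) := by
  rw [Complex.norm_exp]; simp [Complex.mul_re]

/-- The principal branch, written through `branch`. -/
def principalBranch (t ρ : ℝ) (θ : ℂ) : ℂ :=
  θ + Complex.I * t * branch t ρ (Complex.exp (2 * Complex.I * θ))

namespace Contour

lemma norm_exp_le (C : Contour t ρ R) {θ : ℂ} (hθ : 0 ≤ θ.im) :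
    ‖Complex.exp (2 * Complex.I * θ)‖ ≤ R := by
  rw [norm_exp_two_I_mul]
  exact (Real.exp_le_one_iff.2 (by linarith)).trans C.one_le

lemma norm_exp_lt (C : Contour t ρ R) {θ : ℂ} (hθ : 0 < θ.im) :
    ‖Complex.exp (2 * Complex.I * θ)‖ < R := by
  rw [norm_exp_two_I_mul]
  exact (Real.exp_lt_one_iff.2 (by linarith)).trans_le C.one_le

lemma isPrincipalBranch (C : Contour t ρ R) (ht : 0 < t) :
    IsPrincipalBranch t (principalBranch t ρ) where
  analytic := fun θ hθ => by
    have h1 : AnalyticAt ℂ (branch t ρ) (Complex.exp (2 * Complex.I * θ)) :=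
      C.analyticOnNhd_branch ht _ (by simpa using C.norm_exp_lt hθ)
    have h2 : AnalyticAt ℂ (fun θ => Complex.exp (2 * Complex.I * θ)) θ := by fun_prop
    exact analyticAt_id.add (analyticAt_const.mul
      (AnalyticAt.comp (f := fun θ => Complex.exp (2 * Complex.I * θ)) h1 h2))
  continuous := by
    refine continuousOn_id.add (continuousOn_const.mul ((C.continuousOn_branch ht).comp
      (by fun_prop) fun θ hθ => ?_))
    simpa using C.norm_exp_le hθ
  equation := fun θ hθ => by
    have h0 := C.defect_branch (C.norm_exp_le hθ.le)
    have h1 := (defect_eq_zero_iff_sin θ _).1 h0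
    have h2 : Complex.cos (principalBranch t ρ θ) ≠ 0 := fun hc => by
      rw [← principalBranch, hc, mul_zero] at h1
      have := Complex.sin_sq_add_cos_sq (principalBranch t ρ θ)
      rw [h1, hc] at this
      norm_num at this
    rw [← principalBranch] at h1
    rw [Complex.tan_eq_sin_div_cos, h1, mul_div_cancel_right₀ _ h2, principalBranch]
    ring
  bounded := by
    refine ⟨1, one_pos, t * (1 + ρ), fun θ hθ => ?_⟩
    have h1 := C.branch_mem (C.norm_exp_le (by linarith : 0 ≤ θ.im))
    rw [mem_closedBall, dist_eq_norm] at h1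
    have h2 : ‖branch t ρ (Complex.exp (2 * Complex.I * θ))‖ ≤ 1 + ρ := by
      have := norm_add_le (branch t ρ (Complex.exp (2 * Complex.I * θ)) - 1) 1
      rw [sub_add_cancel, norm_one] at this
      linarith
    rw [principalBranch, add_sub_cancel_left, norm_mul, norm_mul, Complex.norm_I, one_mul,
      Complex.norm_real, Real.norm_of_nonneg ht.le]
    gcongr

/-- Any principal branch gives, high up in the half-plane, a root close to `1`, hence agrees with
`principalBranch` there; the identity theorem and continuity do the rest. -/
lemma eqOn_principalBranch (C : Contour t ρ R) (ht : 0 < t) {ξ : ℂ → ℂ}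
    (hξ : IsPrincipalBranch t ξ) : EqOn ξ (principalBranch t ρ) {θ : ℂ | 0 ≤ θ.im} := by
  have ht' : (t : ℂ) ≠ 0 := by exact_mod_cast ht.ne'
  have hζ := C.isPrincipalBranch ht
  obtain ⟨τ₀, hτ₀, B, hB⟩ := hξ.bounded
  set K : ℝ := (1 + B / t) * Real.exp (2 * t * (B / t)) with hK
  obtain ⟨τ₁, hτ₁⟩ : ∃ τ₁ : ℝ, ∀ y ≥ τ₁, Real.exp (-2 * y) * K ≤ ρ := by
    have h1 : Tendsto (fun y : ℝ => Real.exp (-2 * y) * K) atTop (𝓝 (0 * K)) :=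
      (Real.tendsto_exp_atBot.comp
        (tendsto_id.const_mul_atTop_of_neg (by norm_num : (-2 : ℝ) < 0))).mul_const K
    rw [zero_mul] at h1
    exact eventually_atTop.1 (h1.eventually_le_const C.radius_pos)
  have hhigh : ∀ θ : ℂ, τ₀ < θ.im → τ₁ < θ.im → ξ θ = principalBranch t ρ θ := by
    intro θ h0 h1
    have hθ : 0 < θ.im := hτ₀.trans h0
    have heq := hξ.equation θ hθ
    set s : ℂ := -Complex.I * (ξ θ - θ) / t with hs
    have hxs : ξ θ = θ + Complex.I * t * s := by
      rw [hs]; field_simp; linear_combination (ξ θ - θ) * Complex.I_sq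
    have hcos : Complex.cos (ξ θ) ≠ 0 := fun hc => by
      rw [Complex.tan_eq_sin_div_cos, hc, div_zero, mul_zero, sub_zero] at heq
      rw [heq] at hc
      obtain ⟨k, hk⟩ := Complex.cos_eq_zero_iff.1 hc
      have h2 : θ.im = 0 := by
        rw [hk, show ((2 * (k : ℂ) + 1) * Real.pi / 2) = (((2 * k + 1) * Real.pi / 2 : ℝ) : ℂ) by
          push_cast; ring, Complex.ofReal_im]
      exact hθ.ne' h2
    have hdef : defect t (Complex.exp (2 * Complex.I * θ)) s = 0 := by
      rw [defect_eq_zero_iff_sin, ← hxs]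
      rw [Complex.tan_eq_sin_div_cos] at heq
      have h3 : Complex.sin (ξ θ) / Complex.cos (ξ θ) = Complex.I * s := by
        apply mul_left_cancel₀ ht'
        rw [hxs] at heq ⊢
        linear_combination -heq
      rw [← h3, div_mul_cancel₀ _ hcos]
    have hsn : ‖s‖ ≤ B / t := by
      rw [hs, norm_div, norm_mul, norm_neg, Complex.norm_I, one_mul, Complex.norm_real,
        Real.norm_of_nonneg ht.le]
      exact div_le_div_of_nonneg_right (hB θ h0) ht.le
    have hsb : s ∈ closedBall (1 : ℂ) ρ := by
      rw [mem_closedBall, dist_eq_norm]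
      refine le_trans ?_ (hτ₁ θ.im h1.le)
      have h4 : s - 1 = -(Complex.exp (2 * Complex.I * θ) * kernel t s) := by
        unfold defect at hdef; linear_combination hdef
      rw [h4, norm_neg, norm_mul, norm_exp_two_I_mul, hK, kernel, norm_mul, Complex.norm_exp]
      have h5 : ‖1 + s‖ ≤ 1 + B / t := (norm_add_le _ _).trans (by rw [norm_one]; linarith)
      have h6 : (-(2 * t * s)).re ≤ 2 * t * (B / t) := by
        have h7 : (-(2 * (t : ℂ) * s)).re = 2 * t * (-s.re) := by simp [Complex.mul_re]
        rw [h7]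
        have h8 := (abs_le.1 (Complex.abs_re_le_norm s)).1
        gcongr
        linarith
      gcongr
      exact le_trans (norm_nonneg _) h5
    rw [hxs, principalBranch, C.branch_eq ht (C.norm_exp_le hθ.le) hsb hdef]
  have hopen : EqOn ξ (principalBranch t ρ) {θ : ℂ | 0 < θ.im} := by
    set T : ℝ := max τ₀ τ₁ + 1 with hT
    have hT0 : τ₀ < T := by rw [hT]; linarith [le_max_left τ₀ τ₁]
    have hT1 : τ₁ < T := by rw [hT]; linarith [le_max_right τ₀ τ₁]
    refine hξ.analytic.eqOn_of_preconnected_of_eventuallyEq hζ.analytic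
      (convex_halfSpace_im_gt 0).isPreconnected (z₀ := T * Complex.I)
      (by simpa using hτ₀.trans hT0) ?_
    have ho : IsOpen {θ : ℂ | τ₀ < θ.im ∧ τ₁ < θ.im} :=
      (isOpen_lt continuous_const Complex.continuous_im).inter
        (isOpen_lt continuous_const Complex.continuous_im)
    filter_upwards [ho.mem_nhds (show (T * Complex.I : ℂ) ∈ _ by simpa using ⟨hT0, hT1⟩)] with θ hθ
    exact hhigh θ hθ.1 hθ.2
  refine hopen.of_subset_closure hξ.continuous hζ.continuous (fun θ (hθ : 0 < θ.im) => hθ.le) ?_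
  have := Complex.closure_setOfPred_lt_im 0
  rw [this]

/-- `branch` commutes with complex conjugation, so it is real on the real axis. -/
lemma im_branch_ofReal (C : Contour t ρ R) (ht : 0 < t) {x : ℝ} (hx : |x| ≤ R) :
    (branch t ρ x).im = 0 := by
  have hx' : ‖(x : ℂ)‖ ≤ R := by simpa using hx
  have h1 := C.branch_mem hx'
  have h2 := C.defect_branch hx'
  rw [← Complex.conj_eq_iff_im]
  refine (C.branch_eq ht hx' ?_ ?_).symm
  · rw [mem_closedBall, dist_eq_norm] at h1 ⊢
    rw [show (starRingEnd ℂ) (branch t ρ x) - 1 = (starRingEnd ℂ) (branch t ρ x - 1) by simp,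
      RCLike.norm_conj]
    exact h1
  · have h3 := congrArg (starRingEnd ℂ) h2
    simp only [defect, kernel, map_add, map_sub, map_mul, map_one, map_zero, map_neg,
      ← Complex.exp_conj, Complex.conj_ofReal, map_ofNat] at h3
    exact h3

lemma strictAntiOn_branch (C : Contour t ρ R) (ht : 0 < t) :
    StrictAntiOn (fun x : ℝ => (branch t ρ (x : ℂ)).re) (Ioo (-1 : ℝ) 1) := by
  have hle : ∀ x ∈ Ioo (-1 : ℝ) 1, |x| ≤ R := fun x hx =>
    (abs_lt.2 hx).le.trans C.one_le
  have hre : ∀ x ∈ Ioo (-1 : ℝ) 1, ((branch t ρ (x : ℂ)).re : ℂ) = branch t ρ x := fun x hx =>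
    Complex.ext (by simp) (by simpa using (C.im_branch_ofReal ht (hle x hx)).symm)
  have hc : ContinuousOn (fun x : ℝ => (branch t ρ (x : ℂ)).re) (Ioo (-1 : ℝ) 1) :=
    Complex.continuous_re.comp_continuousOn ((C.continuousOn_branch ht).comp
      (by fun_prop) fun x hx => by simpa using hle x hx)
  have hi : InjOn (fun x : ℝ => (branch t ρ (x : ℂ)).re) (Ioo (-1 : ℝ) 1) := by
    intro x hx y hy hxy
    have h1 : branch t ρ x = branch t ρ y := by rw [← hre x hx, ← hre y hy]; exact_mod_cast hxy
    have h2 := C.cayleyExp_branch (z := x) (by simpa using hle x hx)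
    rw [h1, C.cayleyExp_branch (z := y) (by simpa using hle y hy)] at h2
    exact_mod_cast h2.symm
  refine (hc.strictMonoOn_of_injOn_Ioo (by norm_num) hi).resolve_left fun hm => ?_
  -- the values at `0` and `1/2` decide the direction
  have hh : (1 / 2 : ℝ) ∈ Ioo (-1 : ℝ) 1 := by norm_num
  have h0 : (0 : ℝ) ∈ Ioo (-1 : ℝ) 1 := by norm_num
  have h1 := hm h0 hh (by norm_num)
  simp only [Complex.ofReal_zero, C.branch_zero ht, Complex.one_re] at h1
  set a := (branch t ρ ((1 / 2 : ℝ) : ℂ)).re with ha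
  have h2 := C.cayleyExp_branch (z := ((1 / 2 : ℝ) : ℂ)) (by
    rw [Complex.norm_real]; exact hle _ hh)
  rw [← hre _ hh, ← ha, cayleyExp] at h2
  have h3 : Real.exp (2 * t * a) * ((1 - a) / (1 + a)) = 1 / 2 := by exact_mod_cast h2
  have h4 : (1 - a) / (1 + a) < 0 := div_neg_of_neg_of_pos (by linarith) (by linarith)
  nlinarith [Real.exp_pos (2 * t * a)]

end Contour

/-! ### Roots on the circle -/

lemma norm_one_add_sq (w : ℂ) : ‖1 + w‖ ^ 2 = ‖w - 1‖ ^ 2 + 4 * w.re := by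
  rw [Complex.sq_norm, Complex.sq_norm, Complex.normSq_apply, Complex.normSq_apply]
  simp
  ring

lemma one_add_mul_exp_neg_le (y : ℝ) : (1 + y) * Real.exp (-y) ≤ 1 := by
  rw [Real.exp_neg, ← div_eq_mul_inv, div_le_one (Real.exp_pos y)]
  linarith [Real.add_one_le_exp y]

lemma one_add_mul_exp_neg_lt {y : ℝ} (hy : y ≠ 0) : (1 + y) * Real.exp (-y) < 1 := by
  rw [Real.exp_neg, ← div_eq_mul_inv, div_lt_one (Real.exp_pos y)]
  linarith [Real.add_one_lt_exp hy]

lemma norm_sub_one_sq_of_defect {z w : ℂ} (h : defect t z w = 0) :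
    ‖w - 1‖ ^ 2 = ‖z‖ ^ 2 * ((‖w - 1‖ ^ 2 + 4 * w.re) * Real.exp (-(4 * t * w.re))) := by
  have h1 : w - 1 = -(z * kernel t w) := by unfold defect at h; linear_combination h
  rw [← norm_one_add_sq, ← norm_kernel_sq, ← mul_pow, ← norm_mul, ← norm_neg (z * _), ← h1]

/-- The root can touch the circle only at a critical point. -/
lemma Contour.critical_of_not_mem_ball (C : Contour t ρ R) {z : ℂ} (hz : ‖z‖ ≤ R)
    (hb : branch t ρ z ∉ ball (1 : ℂ) ρ) :
    branch t ρ z ∈ sphere (1 : ℂ) ρ ∧ t * (1 - branch t ρ z ^ 2) = 1 := by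
  have hs : branch t ρ z ∈ sphere (1 : ℂ) ρ := by
    rw [mem_ball, not_lt] at hb
    exact le_antisymm (C.branch_mem hz) hb
  have h2 := C.defect_branch hz
  exact ⟨hs, (deriv_defect_eq_zero_iff h2).1 (C.deriv_defect_eq_zero hz hs h2)⟩

/-! ### The contour for `t ≤ 1` -/

lemma inv_sqrt_sq (ht : 0 < t) : (1 / √t) ^ 2 = 1 / t := by
  rw [div_pow, Real.sq_sqrt ht.le, one_pow]

/-- On the circle of radius `1 / √t` one has `t |kernel|² = (1 + 4tx) e^{-4tx}`, `x = Re w`. -/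
lemma contour_inv_sqrt (ht : 0 < t) : Contour t (1 / √t) 1 where
  radius_pos := by positivity
  one_le := le_rfl
  norm_le := fun w hw => by
    have hw' : ‖w - 1‖ = 1 / √t := by simpa [dist_eq_norm] using hw
    rw [one_mul]
    refine le_of_sq_le_sq ?_ (by positivity)
    rw [norm_kernel_sq, norm_one_add_sq, hw', inv_sqrt_sq ht]
    have h1 := one_add_mul_exp_neg_le (4 * t * w.re)
    calc _ = 1 / t * ((1 + 4 * t * w.re) * Real.exp (-(4 * t * w.re))) := by field_simp
      _ ≤ 1 / t * 1 := by gcongr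
      _ = _ := mul_one _
  critical := fun w hw h => by
    have hw' : ‖w - 1‖ = 1 / √t := by simpa [dist_eq_norm] using hw
    rw [one_mul] at h
    have h1 : ‖kernel t w‖ ^ 2 = (1 / √t) ^ 2 := by rw [h]
    rw [norm_kernel_sq, norm_one_add_sq, hw', inv_sqrt_sq ht] at h1
    have h2 : (1 + 4 * t * w.re) * Real.exp (-(4 * t * w.re)) = 1 := by
      field_simp at h1
      rw [mul_comm 4 t]
      exact h1
    have h3 : 4 * t * w.re = 0 := by
      by_contra h4; exact (one_add_mul_exp_neg_lt h4).ne h2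
    have h4 : w.re = 0 := by
      rcases mul_eq_zero.1 h3 with h5 | h5
      · linarith
      · exact h5
    have h5 : 1 + w.im ^ 2 = 1 / t := by
      rw [← inv_sqrt_sq ht, ← hw', Complex.sq_norm, Complex.normSq_apply]
      simp [h4]; ring
    have h6 : w ^ 2 = ((-(w.im ^ 2) : ℝ) : ℂ) := by
      conv_lhs => rw [← Complex.re_add_im w, h4]
      push_cast
      linear_combination (w.im : ℂ) ^ 2 * Complex.I_sq
    rw [h6]
    have h7 : t * (1 - -(w.im ^ 2)) = 1 := by rw [sub_neg_eq_add, h5]; field_simp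
    exact_mod_cast h7

/-- If `Re w < 0` then `|1 + w|² ≤ (1 + 4t Re w) |w - 1|²` for `w` in the disk, and the strict
inequality `(1 + y) e^{-y} < 1` contradicts the equation for `w`. -/
lemma re_nonneg_of_defect (ht : 0 < t) {z w : ℂ} (hz : ‖z‖ ≤ 1)
    (hw : w ∈ closedBall (1 : ℂ) (1 / √t)) (h : defect t z w = 0) : 0 ≤ w.re := by
  by_contra! hx
  have h1 := norm_sub_one_sq_of_defect h
  have h2 : ‖w - 1‖ ^ 2 ≤ 1 / t := by
    rw [mem_closedBall, dist_eq_norm] at hw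
    rw [← inv_sqrt_sq ht]; gcongr
  set d := ‖w - 1‖ ^ 2 with hd
  have htd : t * d ≤ 1 := by rw [le_div_iff₀ ht] at h2; linarith
  have hd0 : 0 < d := by
    refine pow_pos (norm_pos_iff.2 fun h0 => ?_) 2
    rw [sub_eq_zero.1 h0] at hx; norm_num at hx
  have hd1 : 0 ≤ d + 4 * w.re := by rw [hd, ← norm_one_add_sq]; positivity
  have hz2 : ‖z‖ ^ 2 ≤ 1 := pow_le_one₀ (norm_nonneg z) hz
  have he := Real.exp_pos (-(4 * t * w.re))
  have h3 : d ≤ (d + 4 * w.re) * Real.exp (-(4 * t * w.re)) :=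
    h1.le.trans (mul_le_of_le_one_left (by positivity) hz2)
  have h4 : d + 4 * w.re ≤ (1 + 4 * t * w.re) * d := by nlinarith
  have h5 := one_add_mul_exp_neg_lt (y := 4 * t * w.re) (by nlinarith)
  have h6 : (d + 4 * w.re) * Real.exp (-(4 * t * w.re)) ≤
      (1 + 4 * t * w.re) * d * Real.exp (-(4 * t * w.re)) := by gcongr
  nlinarith

lemma re_pos_of_defect (ht : 0 < t) {z w : ℂ} (hz : ‖z‖ < 1)
    (hw : w ∈ closedBall (1 : ℂ) (1 / √t)) (h : defect t z w = 0) : 0 < w.re := by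
  refine lt_of_le_of_ne (re_nonneg_of_defect ht hz.le hw h) fun h0 => ?_
  have h1 := norm_sub_one_sq_of_defect h
  rw [← h0, mul_zero, mul_zero, add_zero, neg_zero, Real.exp_zero, mul_one] at h1
  have hd0 : 0 < ‖w - 1‖ ^ 2 := by
    refine pow_pos (norm_pos_iff.2 fun h2 => ?_) 2
    rw [sub_eq_zero.1 h2] at h0; norm_num at h0
  have : ‖z‖ ^ 2 < 1 := pow_lt_one₀ (norm_nonneg z) hz two_ne_zero
  nlinarith

/-! ### The contour for `t > 1` -/

/-- The positive critical point of `cayleyExp t` for `t > 1`. -/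
def critRe (t : ℝ) : ℝ := √((t - 1) / t)

lemma critRe_sq (ht : 1 < t) : critRe t ^ 2 = (t - 1) / t :=
  Real.sq_sqrt (div_nonneg (by linarith) (by linarith))

lemma critRe_pos (ht : 1 < t) : 0 < critRe t :=
  Real.sqrt_pos.2 (div_pos (by linarith) (by linarith))

lemma critRe_lt_one (ht : 1 < t) : critRe t < 1 := by
  have h1 := critRe_sq ht
  have h2 : (t - 1) / t < 1 := by rw [div_lt_one (by linarith)]; linarith
  nlinarith [critRe_pos ht]

/-- The number `radius t` is the critical value `e^{2tr} (1 - r) / (1 + r)` at `r = critRe t`. -/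
lemma radius_eq (ht : 1 < t) :
    radius t = Real.exp (2 * t * critRe t) * ((1 - critRe t) / (1 + critRe t)) := by
  have h0 : 0 < t := by linarith
  have hs : 0 < √t := Real.sqrt_pos.2 h0
  have h1 : 1 ≤ √t := Real.one_le_sqrt.2 ht.le
  have hc : critRe t = √(t - 1) / √t := Real.sqrt_div (by linarith) t
  have h2 : √(t * (t - 1)) = t * critRe t := by
    rw [Real.sqrt_mul h0.le, hc]
    have := Real.mul_self_sqrt h0.le
    field_simp
    nlinarith [Real.sqrt_nonneg (t - 1)]
  have h3 : Real.exp (2 * Real.arcosh √t) = (√t + √(t - 1)) ^ 2 := by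
    have h4 := Real.exp_arcosh h1
    rw [Real.sq_sqrt h0.le] at h4
    rw [← h4, ← Real.exp_nat_mul]; norm_cast
  rw [radius, Real.exp_sub, h3, h2, mul_assoc, div_eq_mul_inv, hc]
  congr 1
  have h5 := Real.mul_self_sqrt h0.le
  have h6 := Real.mul_self_sqrt (show 0 ≤ t - 1 by linarith)
  have h7 : 0 ≤ √(t - 1) := Real.sqrt_nonneg _
  have h8 : 0 < √t + √(t - 1) := by linarith
  field_simp
  nlinarith

lemma one_lt_radius (ht : 1 < t) : 1 < radius t := by
  have h0 : 0 < t := by linarith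
  have h1 : 1 < √t := by rw [Real.lt_sqrt zero_le_one]; linarith
  rw [radius, Real.one_lt_exp_iff]
  have hu := Real.arcosh_pos h1
  set u := Real.arcosh √t with hu'
  have hs : Real.sinh u = √(t - 1) := by rw [Real.sinh_arcosh h1.le, Real.sq_sqrt h0.le]
  rw [Real.sqrt_mul h0.le, ← hs]
  have h3 := Real.self_lt_sinh_iff.2 hu
  nlinarith

/-- On this circle the square of `R |kernel|` is `(1 - r)²` times
`(1 + 4x / (1 + r)²) e^{-4tx}`, where `r = critRe t` and `x = Re w - r ≥ 0`. -/
lemma contour_radius (ht : 1 < t) : Contour t (1 - critRe t) (radius t) := by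
  have h0 : 0 < t := by linarith
  have hr := critRe_pos ht
  have hr1 := critRe_lt_one ht
  have hR := one_lt_radius ht
  set r := critRe t with hrdef
  have key : ∀ w ∈ sphere (1 : ℂ) (1 - r), r ≤ w.re ∧ (radius t * ‖kernel t w‖) ^ 2 =
      (1 - r) ^ 2 * ((1 + 4 * (w.re - r) / (1 + r) ^ 2) * Real.exp (-(4 * t * (w.re - r)))) := by
    intro w hw
    have hw' : ‖w - 1‖ = 1 - r := by simpa [dist_eq_norm] using hw
    have h1 := (abs_le.1 (Complex.abs_re_le_norm (w - 1))).1
    rw [hw', Complex.sub_re, Complex.one_re] at h1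
    refine ⟨by linarith, ?_⟩
    rw [mul_pow, norm_kernel_sq, norm_one_add_sq, hw', radius_eq ht, ← hrdef, mul_pow,
      ← Real.exp_nat_mul, show -(4 * t * (w.re - r)) = (2 : ℕ) * (2 * t * r) + -(4 * t * w.re) by
        push_cast; ring, Real.exp_add]
    field_simp
    ring
  have hle : ∀ w : ℂ, r ≤ w.re → (1 + 4 * (w.re - r) / (1 + r) ^ 2) ≤ 1 + 4 * t * (w.re - r) := by
    intro w hw
    have h1 : 1 ≤ (1 + r) ^ 2 := one_le_pow₀ (by linarith)
    have h2 : 4 * (w.re - r) / (1 + r) ^ 2 ≤ 4 * (w.re - r) := div_le_self (by linarith) h1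
    nlinarith
  refine ⟨by linarith, hR.le, fun w hw => ?_, fun w hw h => ?_⟩
  · obtain ⟨h1, h2⟩ := key w hw
    refine le_of_sq_le_sq ?_ (by linarith)
    rw [h2]
    refine mul_le_of_le_one_right (by positivity) ?_
    exact (mul_le_mul_of_nonneg_right (hle w h1) (Real.exp_pos _).le).trans
      (one_add_mul_exp_neg_le _)
  · obtain ⟨h1, h2⟩ := key w hw
    have hw' : ‖w - 1‖ = 1 - r := by simpa [dist_eq_norm] using hw
    rw [h] at h2
    have h3 : 1 ≤ (1 + 4 * t * (w.re - r)) * Real.exp (-(4 * t * (w.re - r))) := by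
      have h4 : (0 : ℝ) < (1 - r) ^ 2 := pow_pos (by linarith) 2
      have h5 : (1 + 4 * (w.re - r) / (1 + r) ^ 2) * Real.exp (-(4 * t * (w.re - r))) = 1 :=
        mul_left_cancel₀ h4.ne' (by rw [← h2, mul_one])
      exact h5.symm.le.trans (mul_le_mul_of_nonneg_right (hle w h1) (Real.exp_pos _).le)
    have h4 : w.re = r := by
      by_contra h5
      have h6 : 4 * t * (w.re - r) ≠ 0 :=
        mul_ne_zero (by positivity) (sub_ne_zero.2 h5)
      exact absurd h3 (not_le.2 (one_add_mul_exp_neg_lt h6))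
    have h5 : w.im = 0 := by
      have h6 : ‖w - 1‖ ^ 2 = (w.re - 1) * (w.re - 1) + w.im * w.im := by
        rw [Complex.sq_norm, Complex.normSq_apply]; simp
      rw [hw', h4] at h6
      have : w.im * w.im = 0 := by linarith
      simpa using this
    have h6 : w = (r : ℂ) := Complex.ext (by simp [h4]) (by simp [h5])
    have h7 : t * (1 - r ^ 2) = 1 := by rw [critRe_sq ht]; field_simp; ring
    rw [h6]
    exact_mod_cast h7

lemma branch_mem_ball_of_ne_radius (ht : 1 < t) {z : ℂ} (hz : ‖z‖ ≤ radius t)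
    (hne : z ≠ (radius t : ℂ)) : branch t (1 - critRe t) z ∈ ball (1 : ℂ) (1 - critRe t) := by
  by_contra hb
  have C := contour_radius ht
  obtain ⟨hs, hc⟩ := C.critical_of_not_mem_ball hz hb
  have hr := critRe_pos ht
  have h0 : (t : ℂ) ≠ 0 := by
    have : t ≠ 0 := by linarith
    exact_mod_cast this
  have h1 : branch t (1 - critRe t) z ^ 2 = (critRe t : ℂ) ^ 2 := by
    have : ((critRe t ^ 2 : ℝ) : ℂ) = ((t - 1) / t : ℝ) := by rw [critRe_sq ht]
    push_cast at this
    rw [this]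
    field_simp
    linear_combination -hc
  have h3 := C.cayleyExp_branch hz
  rcases sq_eq_sq_iff_eq_or_eq_neg.1 h1 with h2 | h2
  · apply hne
    rw [← h3, h2, radius_eq ht, cayleyExp]
    push_cast
    rfl
  · rw [mem_sphere, dist_eq_norm, h2, show -(critRe t : ℂ) - 1 = ((-(critRe t + 1) : ℝ) : ℂ) by
      push_cast; ring, Complex.norm_real, norm_neg, Real.norm_of_nonneg (by linarith)] at hs
    linarith

lemma re_branch_pos (ht : 1 < t) {z : ℂ} (hz : ‖z‖ ≤ radius t) :
    0 < (branch t (1 - critRe t) z).re := by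
  have h := (contour_radius ht).branch_mem hz
  rw [mem_closedBall, dist_eq_norm] at h
  have h1 := (abs_le.1 ((Complex.abs_re_le_norm _).trans h)).1
  rw [Complex.sub_re, Complex.one_re] at h1
  linarith [critRe_pos ht]

/-! ### Boundary behaviour for `t ≤ 1` -/

lemma cayleyExp_mul_I (t y : ℝ) :
    cayleyExp t (y * Complex.I) =
      Complex.exp (2 * Complex.I * ((t * y - Real.arctan y : ℝ) : ℂ)) := by
  set a := Real.arctan y with ha
  have hc : (Complex.cos a) ≠ 0 := by
    rw [← Complex.ofReal_cos]; exact_mod_cast (Real.cos_arctan_pos y).ne'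
  have hs : Complex.sin a = y * Complex.cos a := by
    have h1 : Real.sin a = y * Real.cos a := by
      rw [← Real.tan_mul_cos (Real.cos_arctan_pos y).ne', Real.tan_arctan]
    rw [← Complex.ofReal_cos, ← Complex.ofReal_sin, h1]
    push_cast; rfl
  have h1 : Complex.exp (a * Complex.I) = Complex.cos a * (1 + y * Complex.I) := by
    rw [Complex.exp_mul_I, hs]; ring
  have h2 : Complex.exp (-a * Complex.I) = Complex.cos a * (1 - y * Complex.I) := by
    rw [Complex.exp_mul_I, Complex.cos_neg, Complex.sin_neg, hs]; ring
  have h3 : (1 : ℂ) + y * Complex.I ≠ 0 := fun h => by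
    rw [h, mul_zero] at h1; exact Complex.exp_ne_zero _ h1
  have h4 : (1 - y * Complex.I) / (1 + y * Complex.I) = Complex.exp (-(2 * a * Complex.I)) := by
    rw [div_eq_iff h3]
    apply mul_left_cancel₀ hc
    rw [← h2, mul_left_comm, ← h1, ← Complex.exp_add]
    congr 1
    ring
  rw [cayleyExp, h4, ← Complex.exp_add]
  congr 1
  push_cast
  ring

/-- The imaginary part `√((1 - t) / t)` of the critical point of `cayleyExp t` for `t < 1`. -/
def critIm (t : ℝ) : ℝ := √((1 - t) / t)

lemma critIm_sq (ht : 0 < t) (ht1 : t ≤ 1) : critIm t ^ 2 = (1 - t) / t :=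
  Real.sq_sqrt (div_nonneg (by linarith) ht.le)

lemma critIm_pos (ht : 0 < t) (ht1 : t < 1) : 0 < critIm t :=
  Real.sqrt_pos.2 (div_pos (by linarith) ht)

lemma mul_I_mem_closedBall (ht : 0 < t) (ht1 : t ≤ 1) {y : ℝ} (hy : |y| ≤ critIm t) :
    (y * Complex.I : ℂ) ∈ closedBall (1 : ℂ) (1 / √t) := by
  rw [mem_closedBall, dist_eq_norm]
  refine le_of_sq_le_sq ?_ (by positivity)
  have h1 : y ^ 2 ≤ critIm t ^ 2 := sq_le_sq.2 (hy.trans (le_abs_self _))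
  rw [critIm_sq ht ht1] at h1
  rw [inv_sqrt_sq ht, Complex.sq_norm, Complex.normSq_apply]
  have h2 : (1 - t) / t = 1 / t - 1 := by field_simp
  simp
  rw [h2, one_div] at h1
  nlinarith

lemma abs_le_critIm_of_mem (ht : 0 < t) (ht1 : t ≤ 1) {y : ℝ}
    (hy : (y * Complex.I : ℂ) ∈ closedBall (1 : ℂ) (1 / √t)) : |y| ≤ critIm t := by
  rw [mem_closedBall, dist_eq_norm] at hy
  have h1 : ‖(y * Complex.I : ℂ) - 1‖ ^ 2 ≤ (1 / √t) ^ 2 := by gcongr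
  rw [inv_sqrt_sq ht, Complex.sq_norm, Complex.normSq_apply] at h1
  simp at h1
  refine abs_le_of_sq_le_sq ?_ (Real.sqrt_nonneg _)
  rw [critIm_sq ht ht1]
  have h2 : (1 - t) / t = 1 / t - 1 := by field_simp
  rw [h2, one_div]
  nlinarith

/-- On the segment of the imaginary axis inside the circle, `branch` inverts
`iy ↦ e^{2i (ty - arctan y)}`. -/
lemma branch_exp_eq (ht : 0 < t) (ht1 : t ≤ 1) {y : ℝ} (hy : |y| ≤ critIm t) :
    branch t (1 / √t) (Complex.exp (2 * Complex.I * ((t * y - Real.arctan y : ℝ) : ℂ))) =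
      y * Complex.I := by
  refine (contour_inv_sqrt ht).branch_eq ht ?_ (mul_I_mem_closedBall ht ht1 hy) ?_
  · rw [norm_exp_two_I_mul, Complex.ofReal_im]; simp
  · refine defect_eq_zero_of_eq (fun h => ?_) (cayleyExp_mul_I t y).symm
    have := congrArg Complex.re h
    simp at this

/-- The critical points `±i critIm t` have the critical values `e^{∓2i x_t}`. -/
lemma mul_critIm_sub_arctan (ht : 0 < t) (ht1 : t < 1) :
    t * critIm t - Real.arctan (critIm t) = -xt t := by
  have hs : 0 < √t := Real.sqrt_pos.2 ht
  have h1 : critIm t = √(1 - t) / √t := Real.sqrt_div (by linarith) t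
  have h5 := Real.mul_self_sqrt ht.le
  have h2 : √(t * (1 - t)) = t * critIm t := by
    rw [Real.sqrt_mul ht.le, h1]
    field_simp
    nlinarith [Real.sqrt_nonneg (1 - t)]
  rw [xt, h2, Real.arccos_eq_arctan hs, Real.sq_sqrt ht.le, ← h1]
  ring

lemma strictAntiOn_mul_sub_arctan (ht : 0 < t) (ht1 : t ≤ 1) :
    StrictAntiOn (fun y : ℝ => t * y - Real.arctan y) (Icc (-critIm t) (critIm t)) := by
  have hd : ∀ y : ℝ, HasDerivAt (fun y : ℝ => t * y - Real.arctan y) (t - 1 / (1 + y ^ 2)) y :=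
    fun y => by simpa using ((hasDerivAt_id y).const_mul t).fun_sub (Real.hasDerivAt_arctan y)
  refine strictAntiOn_of_deriv_neg (convex_Icc _ _)
    (fun y _ => (hd y).continuousAt.continuousWithinAt) fun y hy => ?_
  rw [interior_Icc] at hy
  rw [(hd y).deriv, sub_neg, lt_div_iff₀ (by positivity)]
  have h1 : y ^ 2 < critIm t ^ 2 := by nlinarith [hy.1, hy.2]
  rw [critIm_sq ht ht1, lt_div_iff₀ ht] at h1
  linarith

lemma xt_mem_Ioo (ht : 0 < t) (ht1 : t < 1) : xt t ∈ Ioo 0 (Real.pi / 2) := by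
  have h := mul_critIm_sub_arctan ht ht1
  have hc := critIm_pos ht ht1
  have h1 := strictAntiOn_mul_sub_arctan ht ht1.le (a := 0) (b := critIm t)
    ⟨by linarith, hc.le⟩ ⟨by linarith, le_rfl⟩ hc
  simp only [mul_zero, Real.arctan_zero, sub_zero] at h1
  refine ⟨by linarith, ?_⟩
  have h2 := Real.arctan_lt_pi_div_two (critIm t)
  nlinarith

lemma branch_exp_xt (ht : 0 < t) (ht1 : t < 1) :
    branch t (1 / √t) (Complex.exp (2 * Complex.I * (xt t : ℂ))) = -(critIm t * Complex.I) := by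
  have h1 := branch_exp_eq (t := t) ht ht1.le (y := -critIm t)
    (by rw [abs_neg, abs_of_pos (critIm_pos ht ht1)])
  rw [Real.arctan_neg, show t * -critIm t - -Real.arctan (critIm t) = xt t by
    linarith [mul_critIm_sub_arctan ht ht1]] at h1
  rw [h1]
  push_cast
  ring

lemma branch_exp_neg_xt (ht : 0 < t) (ht1 : t < 1) :
    branch t (1 / √t) (Complex.exp (-(2 * Complex.I * (xt t : ℂ)))) = critIm t * Complex.I := by
  have h1 := branch_exp_eq (t := t) ht ht1.le (y := critIm t)
    (by rw [abs_of_pos (critIm_pos ht ht1)])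
  rw [mul_critIm_sub_arctan ht ht1] at h1
  rw [← h1]
  congr 2
  push_cast
  ring

lemma critIm_critical (ht : 0 < t) (ht1 : t ≤ 1) {c : ℂ}
    (hc : c = critIm t * Complex.I ∨ c = -(critIm t * Complex.I)) :
    (t : ℂ) * (1 - c ^ 2) = 1 := by
  have h1 : c ^ 2 = -((critIm t ^ 2 : ℝ) : ℂ) := by
    rcases hc with rfl | rfl <;> push_cast <;>
      linear_combination (critIm t : ℂ) ^ 2 * Complex.I_sq
  have h0 : (t : ℂ) ≠ 0 := by exact_mod_cast ht.ne'
  rw [h1, critIm_sq ht ht1]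
  push_cast
  field_simp
  ring

lemma eq_critIm_of_critical (ht : 0 < t) (ht1 : t ≤ 1) {c : ℂ}
    (hc : (t : ℂ) * (1 - c ^ 2) = 1) :
    c = critIm t * Complex.I ∨ c = -(critIm t * Complex.I) := by
  have h1 := critIm_critical ht ht1 (c := critIm t * Complex.I) (Or.inl rfl)
  have h0 : (t : ℂ) ≠ 0 := by exact_mod_cast ht.ne'
  refine sq_eq_sq_iff_eq_or_eq_neg.1 (mul_left_cancel₀ h0 ?_)
  linear_combination h1 - hc

lemma branch_mem_ball_of_ne_exp_xt (ht : 0 < t) (ht1 : t < 1) {z : ℂ} (hz : ‖z‖ ≤ 1)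
    (h1 : z ≠ Complex.exp (2 * Complex.I * (xt t : ℂ)))
    (h2 : z ≠ Complex.exp (-(2 * Complex.I * (xt t : ℂ)))) :
    branch t (1 / √t) z ∈ ball (1 : ℂ) (1 / √t) := by
  by_contra hb
  have C := contour_inv_sqrt ht
  have hc := (C.critical_of_not_mem_ball hz hb).2
  have h3 := C.cayleyExp_branch hz
  have hn : ∀ x : ℝ, ‖Complex.exp (2 * Complex.I * (x : ℂ))‖ ≤ 1 := fun x => by
    rw [norm_exp_two_I_mul]; simp
  rcases eq_critIm_of_critical ht ht1.le hc with h | h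
  · apply h2
    rw [← h3, h, ← branch_exp_neg_xt ht ht1]
    refine C.cayleyExp_branch ?_
    have := hn (-xt t)
    push_cast at this
    rwa [mul_neg] at this
  · apply h1
    rw [← h3, h, ← branch_exp_xt ht ht1]
    exact C.cayleyExp_branch (hn _)

lemma extendsAnalyticallyAt_of_analyticAt {r : ℂ → ℂ} {z₀ : ℂ} (h : AnalyticAt ℂ r z₀) :
    ExtendsAnalyticallyAt r z₀ := by
  obtain ⟨ε, hε, ha⟩ := h.exists_ball_analyticOnNhd
  exact ⟨ε, hε, r, ha, fun z _ => rfl⟩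

/-- At a nonzero critical point the derivative of `cayleyExp t` has a simple zero. -/
lemma hasSquareRootSingularity_branch (C : Contour t ρ 1) (ht : 0 < t) {z₀ : ℂ} (hz₀ : ‖z₀‖ = 1)
    (hc : t * (1 - branch t ρ z₀ ^ 2) = 1) (hc0 : branch t ρ z₀ ≠ 0) :
    HasSquareRootSingularity (branch t ρ) z₀ := by
  set c := branch t ρ z₀ with hcdef
  have hz0 : z₀ ≠ 0 := fun h => by simp [h] at hz₀
  have ht' : (t : ℂ) ≠ 0 := by exact_mod_cast ht.ne'
  have h1c : 1 + c ≠ 0 := C.one_add_branch_ne_zero hz₀.le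
  set H : ℂ → ℂ := fun w => Complex.exp (2 * t * w) * (-2 * t * (w + c)) / (1 + w) ^ 2 with hH
  have hHa : AnalyticAt ℂ H c := by
    rw [hH]; fun_prop (disch := exact pow_ne_zero _ h1c)
  have hHc : H c ≠ 0 := by
    refine div_ne_zero (mul_ne_zero (Complex.exp_ne_zero _) (mul_ne_zero (by simpa using ht.ne') ?_))
      (pow_ne_zero _ h1c)
    rw [← two_mul]; exact mul_ne_zero two_ne_zero hc0
  have hd : ∀ᶠ w in 𝓝 c, deriv (cayleyExp t) w = (w - c) ^ (2 - 1) * H w := by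
    have : ∀ᶠ w in 𝓝 c, 1 + w ≠ 0 := (by fun_prop : ContinuousAt (fun w : ℂ => 1 + w) c)
      |>.eventually_ne h1c
    filter_upwards [this] with w hw
    rw [(hasDerivAt_cayleyExp hw).deriv, hH]
    field_simp
    linear_combination hc
  obtain ⟨ψ, hψ, -, hψd, hψe⟩ := C.exists_eq_comp_rootBranch ht hz₀ two_ne_zero hHa hHc hd
  -- `η` converts the root of `1 - z / z₀` into a root of `z - z₀`
  obtain ⟨η, hη⟩ := IsAlgClosed.exists_pow_nat_eq (-z₀) two_pos
  have hη0 : η ≠ 0 := fun h => hz0 (by rw [h] at hη; simpa using hη.symm)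
  have hβ := continuousOn_rootBranch hz₀ two_ne_zero
  have hmem : z₀ ∈ closedBall (0 : ℂ) 1 := by simp [hz₀]
  have hβz₀ : rootBranch z₀ 2 z₀ = 0 := by
    have := rootBranch_pow z₀ two_ne_zero z₀
    rwa [div_self hz0, sub_self, pow_eq_zero_iff two_ne_zero] at this
  have hβt : Tendsto (rootBranch z₀ 2) (𝓝[closedBall 0 1] z₀) (𝓝 0) := by
    have := hβ z₀ hmem
    rwa [ContinuousWithinAt, hβz₀] at this
  obtain ⟨a, -, ha1, ha⟩ := eventually_hasSum_of_analyticAt hψ hβt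
  refine ⟨fun z => η * rootBranch z₀ 2 z, continuousOn_const.mul hβ, fun z _ => ?_,
    fun n => a n / η ^ n, ?_, ?_⟩
  · simp only []
    rw [mul_pow, hη, rootBranch_pow z₀ two_ne_zero]
    field_simp
    ring
  · change a 1 / η ^ 1 ≠ 0
    rw [ha1]
    refine div_ne_zero (fun h => ?_) (pow_ne_zero _ hη0)
    rw [h, zero_pow two_ne_zero, eq_comm, neg_eq_zero] at hψd
    exact div_ne_zero (mul_ne_zero (by norm_num) hz0) hHc hψd
  · filter_upwards [ha, hψe] with z hz1 hz2
    rw [hz2]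
    refine hasSum_of_eq hz1 (fun n => ?_) rfl
    rw [mul_pow]
    field_simp

lemma re_branch_eq_zero (ht : 0 < t) (ht1 : t < 1) {θ : ℝ} (hθ : θ ∈ Icc (-xt t) (xt t)) :
    (branch t (1 / √t) (Complex.exp (2 * Complex.I * (θ : ℂ)))).re = 0 := by
  have hc := critIm_pos ht ht1
  have hcont : ContinuousOn (fun y : ℝ => t * y - Real.arctan y)
      (Icc (-critIm t) (critIm t)) :=
    ((continuous_const.mul continuous_id).sub Real.continuous_arctan).continuousOn
  have h := intermediate_value_Icc' (by linarith) hcont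
  simp only [Real.arctan_neg] at h
  rw [mul_critIm_sub_arctan ht ht1, show t * -critIm t - -Real.arctan (critIm t) = xt t by
    linarith [mul_critIm_sub_arctan ht ht1]] at h
  obtain ⟨y, hy, rfl⟩ := h hθ
  rw [branch_exp_eq ht ht1.le (abs_le.2 hy)]
  simp

lemma re_branch_pos_of_notMem (ht : 0 < t) (ht1 : t < 1) {θ : ℝ}
    (hθ : θ ∈ Icc (-(Real.pi / 2)) (Real.pi / 2) \ Icc (-xt t) (xt t)) :
    0 < (branch t (1 / √t) (Complex.exp (2 * Complex.I * (θ : ℂ)))).re := by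
  have C := contour_inv_sqrt ht
  set z := Complex.exp (2 * Complex.I * (θ : ℂ)) with hz
  have hzn : ‖z‖ ≤ 1 := by rw [hz, norm_exp_two_I_mul]; simp
  have hmem := C.branch_mem hzn
  refine lt_of_le_of_ne (re_nonneg_of_defect ht hzn hmem (C.defect_branch hzn)) fun h0 => hθ.2 ?_
  set y := (branch t (1 / √t) z).im with hy
  have hb : branch t (1 / √t) z = y * Complex.I := 
    Complex.ext (by rw [← h0]; simp) (by rw [hy]; simp)
  rw [hb] at hmem
  have hyc := abs_le.1 (abs_le_critIm_of_mem ht ht1.le hmem)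
  have hc := critIm_pos ht ht1
  have hx := xt_mem_Ioo ht ht1
  have hanti := (strictAntiOn_mul_sub_arctan ht ht1.le).antitoneOn
  have h1 := mul_critIm_sub_arctan ht ht1
  have hlo := hanti hyc ⟨by linarith, le_rfl⟩ hyc.2
  have hhi := hanti ⟨le_rfl, by linarith⟩ hyc hyc.1
  simp only [Real.arctan_neg] at hlo hhi
  -- both angles lie in `[-π/2, π/2]`, one of them in the open interval, and agree modulo `π`
  have h2 := C.cayleyExp_branch hzn
  rw [hb, cayleyExp_mul_I, hz, Complex.exp_eq_exp_iff_exists_int] at h2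
  obtain ⟨n, hn⟩ := h2
  have h3 : t * y - Real.arctan y = θ + n * Real.pi := by
    have h4 : (2 * Complex.I) * ((t * y - Real.arctan y : ℝ) : ℂ) =
        (2 * Complex.I) * ((θ + n * Real.pi : ℝ) : ℂ) := by
      rw [hn]; push_cast; ring
    exact_mod_cast mul_left_cancel₀ (mul_ne_zero two_ne_zero Complex.I_ne_zero) h4
  have hpi := Real.pi_pos
  have hn1 : (n : ℝ) < 1 := by
    by_contra! h; nlinarith [hθ.1.1, hx.2]
  have hn2 : (-1 : ℝ) < n := by
    by_contra! h; nlinarith [hθ.1.2, hx.2]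
  have hn0 : n = 0 := by
    have h5 : n < 1 := by exact_mod_cast hn1
    have h6 : -1 < n := by exact_mod_cast hn2
    omega
  rw [hn0] at h3
  simp only [Int.cast_zero, zero_mul, add_zero] at h3
  exact ⟨by linarith, by linarith⟩

lemma branch_one (ht : 0 < t) (ht1 : t ≤ 1) : branch t (1 / √t) 1 = 0 := by
  refine (contour_inv_sqrt ht).branch_eq ht (by simp) ?_ (by simp [defect, kernel])
  have h1 : √t ≤ 1 := Real.sqrt_le_one.2 ht1
  simpa using (one_le_div (Real.sqrt_pos.2 ht)).2 h1

/-- The derivatives come from the differential equation for `branch` and its derivative. -/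
lemma branch_derivs_at_one (ht : 0 < t) (ht1 : t < 1) :
    AnalyticAt ℂ (branch t (1 / √t)) 1 ∧
      deriv (branch t (1 / √t)) 1 = 1 / (2 * (t : ℂ) - 2) ∧
      iteratedDeriv 2 (branch t (1 / √t)) 1 = -(1 / (2 * (t : ℂ) - 2)) := by
  have C := contour_inv_sqrt ht
  have hr1 := branch_one ht ht1.le
  have hs : √t < 1 := by rw [Real.sqrt_lt' one_pos]; linarith
  have hb : branch t (1 / √t) 1 ∈ ball (1 : ℂ) (1 / √t) := by
    rw [hr1]
    simpa using (one_lt_div (Real.sqrt_pos.2 ht)).2 hs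
  obtain ⟨ha, he⟩ := C.eventually_branch ht (by simp) hb
  set r := branch t (1 / √t) with hr
  have ht' : (t : ℂ) - 1 ≠ 0 := by
    have : t - 1 ≠ 0 := by linarith
    exact_mod_cast this
  have hd : deriv r 1 = 1 / (2 * (t : ℂ) - 2) := by
    have h1 := two_mul_deriv_mul_eq ha.differentiableAt he
    rw [hr1] at h1
    rw [eq_div_iff (by rw [← mul_sub_one]; exact mul_ne_zero two_ne_zero ht')]
    linear_combination h1
  refine ⟨ha, hd, ?_⟩
  have hode : (fun z => 2 * z * deriv r z * (t * (1 - r z ^ 2) - 1) - (1 - r z ^ 2)) =ᶠ[𝓝 1]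
      fun _ => 0 := by
    filter_upwards [ha.eventually_analyticAt, he.eventually_nhds] with z hz1 hz2
    rw [two_mul_deriv_mul_eq hz1.differentiableAt hz2, sub_self]
  have h1 := ha.differentiableAt.hasDerivAt
  have h2 := ha.deriv.differentiableAt.hasDerivAt
  have h3 : HasDerivAt (fun z => 1 - r z ^ 2) (-(2 * r 1 ^ (2 - 1) * deriv r 1)) 1 :=
    (h1.pow 2).const_sub 1
  have h5 : HasDerivAt (fun z : ℂ => 2 * z) 2 1 := by
    simpa using (hasDerivAt_id (1 : ℂ)).const_mul 2
  have h4 : HasDerivAt (fun z => 2 * z * deriv r z * (t * (1 - r z ^ 2) - 1) - (1 - r z ^ 2)) _ 1 :=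
    ((h5.mul h2).mul ((h3.const_mul (t : ℂ)).sub_const 1)).sub h3
  have h6 := h4.unique ((hasDerivAt_const (1 : ℂ) (0 : ℂ)).congr_of_eventuallyEq hode)
  simp only [Pi.mul_apply, hr1] at h6
  rw [iteratedDeriv_succ, iteratedDeriv_one, ← hd]
  apply mul_left_cancel₀ (mul_ne_zero two_ne_zero ht')
  linear_combination h6

lemma re_branch_pos_of_t_eq_one {z : ℂ} (hz : ‖z‖ ≤ 1) (hne : z ≠ 1) :
    branch 1 (1 / √1) z ∈ ball (1 : ℂ) (1 / √1) ∧ 0 < (branch 1 (1 / √1) z).re := by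
  have C := contour_inv_sqrt one_pos
  have hb : branch 1 (1 / √1) z ∈ ball (1 : ℂ) (1 / √1) := by
    by_contra hb
    have hc := (C.critical_of_not_mem_ball hz hb).2
    have h0 : branch 1 (1 / √1) z = 0 := by
      push_cast at hc
      have : branch 1 (1 / √1) z ^ 2 = 0 := by linear_combination -hc
      simpa using this
    have h1 := C.cayleyExp_branch hz
    rw [h0] at h1
    exact hne (by rw [← h1]; simp [cayleyExp])
  refine ⟨hb, ?_⟩
  rw [mem_ball, dist_eq_norm] at hb
  have h1 := (abs_lt.1 ((Complex.abs_re_le_norm _).trans_lt hb)).1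
  simp at h1
  simpa using h1

/-- For `t = 1` the derivative of `cayleyExp` has a double zero at `0`; the choice of the cube root
is fixed by positivity on the real axis. -/
lemma exists_cubicRoot_series :
    ∃ a : ℕ → ℂ, a 0 = 0 ∧ a 1 = (((3 / 2 : ℝ) ^ (1 / 3 : ℝ) : ℝ) : ℂ) ∧
      ∀ᶠ z in 𝓝[closedBall (0 : ℂ) 1] 1,
        HasSum (fun n : ℕ => a n * ((1 - z) ^ (1 / 3 : ℂ)) ^ n) (branch 1 (1 / √1) z) := by
  have C := contour_inv_sqrt one_pos
  have hr1 : branch 1 (1 / √1) 1 = 0 := branch_one one_pos le_rfl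
  set r := branch 1 (1 / √1) with hr
  set H : ℂ → ℂ := fun w => Complex.exp (2 * (1 : ℝ) * w) * (-2) / (1 + w) ^ 2 with hH
  have hHa : AnalyticAt ℂ H (r 1) := by
    rw [hH, hr1]; fun_prop (disch := norm_num)
  have hHc : H (r 1) = -2 := by rw [hr1, hH]; simp
  have hd : ∀ᶠ w in 𝓝 (r 1), deriv (cayleyExp 1) w = (w - r 1) ^ (3 - 1) * H w := by
    have : ∀ᶠ w in 𝓝 (r 1), 1 + w ≠ 0 := (by fun_prop : ContinuousAt (fun w : ℂ => 1 + w) (r 1))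
      |>.eventually_ne (by rw [hr1]; norm_num)
    filter_upwards [this] with w hw
    rw [(hasDerivAt_cayleyExp hw).deriv, hH, hr1]
    push_cast
    field_simp
    ring
  obtain ⟨ψ, hψ, hψ0, hψd, hψe⟩ := C.exists_eq_comp_rootBranch one_pos (z₀ := 1) (by simp)
    three_ne_zero hHa (by rw [hHc]; norm_num) hd
  rw [← hr] at hψ0 hψd hψe
  rw [hr1] at hψ0
  rw [hHc] at hψd
  have hβ := continuousOn_rootBranch (z₀ := 1) (by simp) three_ne_zero
  have hβt : Tendsto (rootBranch 1 3) (𝓝[closedBall 0 1] 1) (𝓝 0) := by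
    have := hβ 1 (by simp)
    rwa [ContinuousWithinAt, show rootBranch 1 3 1 = 0 by simp [rootBranch]] at this
  -- along `z = 1 - s³` with `s > 0` small, `ψ s = r z` is real and nonnegative
  have hcurve : Tendsto (fun s : ℝ => ((1 - s ^ 3 : ℝ) : ℂ)) (𝓝[>] 0)
      (𝓝[closedBall (0 : ℂ) 1] 1) := by
    refine tendsto_nhdsWithin_iff.2 ⟨?_, ?_⟩
    · have h1 : Continuous fun s : ℝ => ((1 - s ^ 3 : ℝ) : ℂ) := by fun_prop
      have h2 := h1.tendsto 0
      simp only [ne_eq, OfNat.ofNat_ne_zero, not_false_eq_true, zero_pow, sub_zero,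
        Complex.ofReal_one] at h2
      exact h2.mono_left nhdsWithin_le_nhds
    · filter_upwards [Ioo_mem_nhdsGT (zero_lt_one' ℝ)] with s hs
      have h3 : s ^ 3 ≤ 1 := pow_le_one₀ hs.1.le hs.2.le
      have h4 : 0 < s ^ 3 := pow_pos hs.1 3
      rw [mem_closedBall, dist_zero_right, Complex.norm_real, Real.norm_of_nonneg (by linarith)]
      linarith
  have hreal : ∀ᶠ s : ℝ in 𝓝[>] 0, (ψ s / s) ∈ {x : ℂ | 0 ≤ x.re ∧ x.im = 0} := by
    filter_upwards [hcurve.eventually hψe, hcurve.eventually self_mem_nhdsWithin,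
      self_mem_nhdsWithin] with s hs1 hs2 hs3
    have hs3' : (0 : ℝ) < s := hs3
    have h1 : rootBranch 1 3 ((1 - s ^ 3 : ℝ) : ℂ) = s := by
      rw [rootBranch, div_one, show (1 : ℂ) - ((1 - s ^ 3 : ℝ) : ℂ) = ((s ^ 3 : ℝ) : ℂ) by
        push_cast; ring, show (((3 : ℕ) : ℂ)⁻¹) = ((((3 : ℕ) : ℝ)⁻¹ : ℝ) : ℂ) by push_cast; rfl,
        ← Complex.ofReal_cpow (by positivity), Real.pow_rpow_inv_natCast hs3'.le three_ne_zero]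
    rw [h1] at hs1
    have hn : ‖((1 - s ^ 3 : ℝ) : ℂ)‖ ≤ 1 := by simpa using hs2
    have h2 := C.im_branch_ofReal one_pos (x := 1 - s ^ 3) (by
      rwa [Complex.norm_real, Real.norm_eq_abs] at hn)
    have h3 := re_nonneg_of_defect one_pos hn (C.branch_mem hn) (C.defect_branch hn)
    rw [← hr] at h2 h3
    change 0 ≤ _ ∧ _ = (0 : ℝ)
    rw [← hs1, Complex.div_ofReal_re, Complex.div_ofReal_im, h2, zero_div]
    exact ⟨div_nonneg h3 hs3'.le, rfl⟩
  have hlim : Tendsto (fun s : ℝ => ψ s / s) (𝓝[>] 0) (𝓝 (deriv ψ 0)) := by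
    have h1 := hasDerivAt_iff_tendsto_slope.1 hψ.differentiableAt.hasDerivAt
    have h2 : Tendsto (fun s : ℝ => (s : ℂ)) (𝓝[>] 0) (𝓝[≠] 0) := by
      refine tendsto_nhdsWithin_iff.2 ⟨?_, ?_⟩
      · have := Complex.continuous_ofReal.tendsto 0
        rw [Complex.ofReal_zero] at this
        exact this.mono_left nhdsWithin_le_nhds
      · filter_upwards [self_mem_nhdsWithin] with s hs
        have hs' : (0 : ℝ) < s := hs
        simpa using hs'.ne'
    refine (h1.comp h2).congr fun s => ?_
    simp [slope_def_field, hψ0]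
  have hclosed : IsClosed {x : ℂ | 0 ≤ x.re ∧ x.im = 0} :=
    (isClosed_le continuous_const Complex.continuous_re).inter
      (isClosed_eq Complex.continuous_im continuous_const)
  obtain ⟨hre, him⟩ := hclosed.mem_of_tendsto hlim hreal
  have hval : deriv ψ 0 = (((3 / 2 : ℝ) ^ (1 / 3 : ℝ) : ℝ) : ℂ) := by
    have h1 : deriv ψ 0 = ((deriv ψ 0).re : ℂ) := Complex.ext (by simp) (by simp [him])
    rw [h1] at hψd ⊢
    have h2 : (deriv ψ 0).re ^ 3 = 3 / 2 := by
      have h3 : (((deriv ψ 0).re ^ 3 : ℝ) : ℂ) = ((3 / 2 : ℝ) : ℂ) := by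
        push_cast; rw [hψd]; norm_num
      exact_mod_cast h3
    rw [← h2, one_div, show (3 : ℝ)⁻¹ = ((3 : ℕ) : ℝ)⁻¹ by norm_num,
      Real.pow_rpow_inv_natCast hre three_ne_zero]
  obtain ⟨a, ha0, ha1, ha⟩ := eventually_hasSum_of_analyticAt hψ hβt
  refine ⟨a, ha0.trans hψ0, ha1.trans hval, ?_⟩
  filter_upwards [ha, hψe] with z hz1 hz2
  rw [hz2]
  refine hasSum_of_eq hz1 (fun n => ?_) rfl
  simp [rootBranch]

/-! ### Singularities on the unit circle, and the theorem -/

lemma Contour.tendsto_taylorPartialSum (C : Contour t ρ R) (ht : 0 < t) {z : ℂ} (hz : ‖z‖ ≤ R) :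
    Tendsto (fun N : ℕ => taylorPartialSum t N z) atTop (𝓝 (branch t ρ z)) :=
  (C.tendstoUniformlyOn_taylorPartialSum ht).tendsto_at (by simpa using hz)

lemma analyticAt_branch_of_ne_exp_xt (ht : 0 < t) (ht1 : t < 1) {z : ℂ} (hz : ‖z‖ ≤ 1)
    (h1 : z ≠ Complex.exp (2 * Complex.I * (xt t : ℂ)))
    (h2 : z ≠ Complex.exp (-(2 * Complex.I * (xt t : ℂ)))) :
    AnalyticAt ℂ (branch t (1 / √t)) z :=
  (contour_inv_sqrt ht).analyticAt_branch ht hz (branch_mem_ball_of_ne_exp_xt ht ht1 hz h1 h2)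

lemma hasSquareRootSingularity_exp_xt (ht : 0 < t) (ht1 : t < 1) :
    HasSquareRootSingularity (branch t (1 / √t))
        (Complex.exp (2 * Complex.I * (xt t : ℂ))) ∧
      HasSquareRootSingularity (branch t (1 / √t))
        (Complex.exp (-(2 * Complex.I * (xt t : ℂ)))) := by
  have hc : (critIm t * Complex.I : ℂ) ≠ 0 :=
    mul_ne_zero (by exact_mod_cast (critIm_pos ht ht1).ne') Complex.I_ne_zero
  have hn : ‖Complex.exp (2 * Complex.I * (xt t : ℂ))‖ = 1 := by
    rw [norm_exp_two_I_mul, Complex.ofReal_im]; simp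
  refine ⟨hasSquareRootSingularity_branch (contour_inv_sqrt ht) ht hn ?_ ?_,
    hasSquareRootSingularity_branch (contour_inv_sqrt ht) ht ?_ ?_ ?_⟩
  · exact critIm_critical ht ht1.le (Or.inr (branch_exp_xt ht ht1))
  · rw [branch_exp_xt ht ht1]; exact neg_ne_zero.2 hc
  · rw [Complex.exp_neg, norm_inv, hn, inv_one]
  · exact critIm_critical ht ht1.le (Or.inl (branch_exp_neg_xt ht ht1))
  · rwa [branch_exp_neg_xt ht ht1]

/-- For `t ≤ 1` the unit circle carries a critical value, hence the divergence outside the disk. -/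
lemma exists_critical_on_unit_circle (ht : 0 < t) (ht1 : t ≤ 1) :
    ∃ z₀ : ℂ, ‖z₀‖ = 1 ∧ t * (1 - branch t (1 / √t) z₀ ^ 2) = 1 := by
  have hb := branch_exp_eq ht ht1 (y := critIm t) (abs_of_nonneg (Real.sqrt_nonneg _)).le
  refine ⟨_, ?_, critIm_critical ht ht1 (Or.inl hb)⟩
  rw [norm_exp_two_I_mul, Complex.ofReal_im]; simp

end UnitaryPoisson

end

theorem mainTheorem7 :
    -- `q_m` has degree `m`
    (∀ m : ℕ, (UnitaryPoisson.q m).degree = (m : WithBot ℕ)) ∧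
    ∀ t : ℝ, 0 < t →
    -- the principal branch `ζ` exists and is unique
    ∃ ζ : ℂ → ℂ, UnitaryPoisson.IsPrincipalBranch t ζ ∧
      (∀ ξ : ℂ → ℂ, UnitaryPoisson.IsPrincipalBranch t ξ → EqOn ξ ζ {θ : ℂ | 0 ≤ θ.im}) ∧
    -- `r` is analytic on the disk; its values elsewhere are those of its extensions described below
    ∃ r : ℂ → ℂ,
      AnalyticOnNhd ℂ r (ball (0 : ℂ) 1) ∧
      (∀ θ : ℂ, 0 < θ.im →
        ζ θ = θ + Complex.I * (t : ℂ) * r (Complex.exp (2 * Complex.I * θ))) ∧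
      (∀ z ∈ ball (0 : ℂ) 1, z = Complex.exp (2 * (t : ℂ) * r z) * ((1 - r z) / (1 + r z))) ∧
      (∀ z ∈ ball (0 : ℂ) 1,
        Tendsto (fun N : ℕ => UnitaryPoisson.taylorPartialSum t N z) atTop (𝓝 (r z))) ∧
      (∀ z ∈ ball (0 : ℂ) 1, 0 < (r z).re) ∧
      (∀ x ∈ Ioo (-1 : ℝ) 1, (r (x : ℂ)).im = 0) ∧
      StrictAntiOn (fun x : ℝ => (r (x : ℂ)).re) (Ioo (-1 : ℝ) 1) ∧
      r 0 = 1 ∧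
      -- (i)
      (1 < t →
        1 < UnitaryPoisson.radius t ∧
        (∀ z ∈ closedBall (0 : ℂ) (UnitaryPoisson.radius t),
          z ≠ (UnitaryPoisson.radius t : ℂ) → AnalyticAt ℂ r z) ∧
        ContinuousOn r (closedBall (0 : ℂ) (UnitaryPoisson.radius t)) ∧
        TendstoUniformlyOn (UnitaryPoisson.taylorPartialSum t) r atTop
          (closedBall (0 : ℂ) (UnitaryPoisson.radius t)) ∧
        TendstoUniformlyOn (UnitaryPoisson.taylorPartialSum t) r atTop (sphere (0 : ℂ) 1) ∧
        ∀ z ∈ sphere (0 : ℂ) 1, 0 < (r z).re) ∧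
      -- (ii)
      (t ≤ 1 →
        ContinuousOn r (closedBall (0 : ℂ) 1) ∧
        TendstoUniformlyOn (UnitaryPoisson.taylorPartialSum t) r atTop (closedBall (0 : ℂ) 1) ∧
        (∀ z : ℂ, 1 < ‖z‖ →
          ¬ ∃ w : ℂ, Tendsto (fun N : ℕ => UnitaryPoisson.taylorPartialSum t N z) atTop (𝓝 w)) ∧
        r 1 = 0) ∧
      -- (iii)
      (t < 1 →
        UnitaryPoisson.xt t ∈ Ioo 0 (Real.pi / 2) ∧
        (∀ z₀ ∈ sphere (0 : ℂ) 1,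
          z₀ ≠ Complex.exp (2 * Complex.I * (UnitaryPoisson.xt t : ℂ)) →
          z₀ ≠ Complex.exp (-(2 * Complex.I * (UnitaryPoisson.xt t : ℂ))) →
          UnitaryPoisson.ExtendsAnalyticallyAt r z₀) ∧
        UnitaryPoisson.HasSquareRootSingularity r
          (Complex.exp (2 * Complex.I * (UnitaryPoisson.xt t : ℂ))) ∧
        UnitaryPoisson.HasSquareRootSingularity r
          (Complex.exp (-(2 * Complex.I * (UnitaryPoisson.xt t : ℂ)))) ∧
        (∀ θ ∈ Icc (-UnitaryPoisson.xt t) (UnitaryPoisson.xt t),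
          (r (Complex.exp (2 * Complex.I * (θ : ℂ)))).re = 0) ∧
        (∀ θ ∈ Icc (-(Real.pi / 2)) (Real.pi / 2) \
            Icc (-UnitaryPoisson.xt t) (UnitaryPoisson.xt t),
          0 < (r (Complex.exp (2 * Complex.I * (θ : ℂ)))).re) ∧
        ∃ F : ℂ → ℂ, AnalyticAt ℂ F 1 ∧ (∀ᶠ z in 𝓝[closedBall (0 : ℂ) 1] 1, F z = r z) ∧
          deriv F 1 = 1 / (2 * (t : ℂ) - 2) ∧
          iteratedDeriv 2 F 1 = -(1 / (2 * (t : ℂ) - 2))) ∧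
      -- (iv)
      (t = 1 →
        (∀ z₀ ∈ sphere (0 : ℂ) 1, z₀ ≠ 1 → UnitaryPoisson.ExtendsAnalyticallyAt r z₀) ∧
        (∃ a : ℕ → ℂ, a 0 = 0 ∧ a 1 = (((3 / 2 : ℝ) ^ (1 / 3 : ℝ) : ℝ) : ℂ) ∧
          ∀ᶠ z in 𝓝[closedBall (0 : ℂ) 1] 1,
            HasSum (fun n : ℕ => a n * ((1 - z) ^ (1 / 3 : ℂ)) ^ n) (r z)) ∧
        (∀ z ∈ sphere (0 : ℂ) 1, z ≠ 1 → 0 < (r z).re) ∧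
        r 1 = 0) := by
  refine ⟨UnitaryPoisson.degree_q, fun t ht => ?_⟩
  -- the part common to all `t`: any admissible circle gives the branch and its Taylor series
  have common : ∀ {ρ R : ℝ}, UnitaryPoisson.Contour t ρ R →
      UnitaryPoisson.IsPrincipalBranch t (UnitaryPoisson.principalBranch t ρ) ∧
      (∀ ξ : ℂ → ℂ, UnitaryPoisson.IsPrincipalBranch t ξ →
        EqOn ξ (UnitaryPoisson.principalBranch t ρ) {θ : ℂ | 0 ≤ θ.im}) ∧
      AnalyticOnNhd ℂ (UnitaryPoisson.branch t ρ) (ball (0 : ℂ) 1) ∧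
      (∀ z ∈ ball (0 : ℂ) 1, z = Complex.exp (2 * (t : ℂ) * UnitaryPoisson.branch t ρ z) *
        ((1 - UnitaryPoisson.branch t ρ z) / (1 + UnitaryPoisson.branch t ρ z))) ∧
      (∀ z ∈ ball (0 : ℂ) 1, Tendsto (fun N : ℕ => UnitaryPoisson.taylorPartialSum t N z) atTop
        (𝓝 (UnitaryPoisson.branch t ρ z))) ∧
      (∀ x ∈ Ioo (-1 : ℝ) 1, (UnitaryPoisson.branch t ρ (x : ℂ)).im = 0) := fun {ρ R} C => by
    have hR : ∀ z ∈ ball (0 : ℂ) 1, ‖z‖ ≤ R := fun z hz =>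
      (mem_ball_zero_iff.1 hz).le.trans C.one_le
    exact ⟨C.isPrincipalBranch ht, fun ξ hξ => C.eqOn_principalBranch ht hξ,
      (C.analyticOnNhd_branch ht).mono (ball_subset_ball C.one_le),
      fun z hz => UnitaryPoisson.eq_exp_mul_of_defect (C.defect_branch (hR z hz)),
      fun z hz => C.tendsto_taylorPartialSum ht (hR z hz),
      fun x hx => C.im_branch_ofReal ht ((abs_lt.2 hx).le.trans C.one_le)⟩
  rcases lt_or_ge 1 t with ht1 | ht1
  · have C := UnitaryPoisson.contour_radius ht1
    have hR := UnitaryPoisson.one_lt_radius ht1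
    obtain ⟨h1, h2, h3, h4, h5, h6⟩ := common C
    have hu := C.tendstoUniformlyOn_taylorPartialSum ht
    refine ⟨_, h1, h2, _, h3, fun θ _ => rfl, h4, h5,
      fun z hz => UnitaryPoisson.re_branch_pos ht1 ((mem_ball_zero_iff.1 hz).le.trans hR.le), h6,
      C.strictAntiOn_branch ht, C.branch_zero ht, fun _ => ⟨hR, fun z hz hne => ?_,
        C.continuousOn_branch ht, hu, hu.mono fun z hz => ?_, fun z hz => ?_⟩,
      fun h => absurd ht1 h.not_gt, fun h => absurd ht1 h.not_gt, fun h => absurd ht1 h.le.not_gt⟩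
    · exact C.analyticAt_branch ht (mem_closedBall_zero_iff.1 hz)
        (UnitaryPoisson.branch_mem_ball_of_ne_radius ht1 (mem_closedBall_zero_iff.1 hz) hne)
    · exact mem_closedBall_zero_iff.2 ((mem_sphere_zero_iff_norm.1 hz).le.trans hR.le)
    · exact UnitaryPoisson.re_branch_pos ht1 ((mem_sphere_zero_iff_norm.1 hz).le.trans hR.le)
  · have C := UnitaryPoisson.contour_inv_sqrt ht
    obtain ⟨h1, h2, h3, h4, h5, h6⟩ := common C
    refine ⟨_, h1, h2, _, h3, fun θ _ => rfl, h4, h5, fun z hz => ?_, h6,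
      C.strictAntiOn_branch ht, C.branch_zero ht, fun h => absurd h ht1.not_gt,
      fun _ => ⟨C.continuousOn_branch ht, C.tendstoUniformlyOn_taylorPartialSum ht,
        fun z hz => ?_, UnitaryPoisson.branch_one ht ht1⟩, fun ht2 => ?_, fun ht2 => ?_⟩
    · have hz' : ‖z‖ < 1 := mem_ball_zero_iff.1 hz
      exact UnitaryPoisson.re_pos_of_defect ht hz' (C.branch_mem hz'.le) (C.defect_branch hz'.le)
    · obtain ⟨z₀, hz₀, hc⟩ := UnitaryPoisson.exists_critical_on_unit_circle ht ht1
      exact C.not_tendsto_taylorPartialSum ht hz₀ hc hz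
    · obtain ⟨hs1, hs2⟩ := UnitaryPoisson.hasSquareRootSingularity_exp_xt ht ht2
      obtain ⟨ha, hd1, hd2⟩ := UnitaryPoisson.branch_derivs_at_one ht ht2
      exact ⟨UnitaryPoisson.xt_mem_Ioo ht ht2,
        fun z hz hz1 hz2 => UnitaryPoisson.extendsAnalyticallyAt_of_analyticAt
          (UnitaryPoisson.analyticAt_branch_of_ne_exp_xt ht ht2
            (mem_sphere_zero_iff_norm.1 hz).le hz1 hz2), hs1, hs2,
        fun θ hθ => UnitaryPoisson.re_branch_eq_zero ht ht2 hθ,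
        fun θ hθ => UnitaryPoisson.re_branch_pos_of_notMem ht ht2 hθ,
        _, ha, .of_forall fun _ => rfl, hd1, hd2⟩
    · subst ht2
      have hpos := fun (z : ℂ) (hz : z ∈ sphere (0 : ℂ) 1) =>
        UnitaryPoisson.re_branch_pos_of_t_eq_one (mem_sphere_zero_iff_norm.1 hz).le
      exact ⟨fun z hz hne => UnitaryPoisson.extendsAnalyticallyAt_of_analyticAt
          (C.analyticAt_branch ht (mem_sphere_zero_iff_norm.1 hz).le (hpos z hz hne).1),
        UnitaryPoisson.exists_cubicRoot_series, fun z hz hne => (hpos z hz hne).2,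
        UnitaryPoisson.branch_one ht ht1⟩
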